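/- All vector spaces are finite-dimensional over $\mathbb{C}$. A quadratic Lie algebra is a Lie algebra $\mathfrak g$ with a non-degenerate symmetric bilinear form $B$ such that $B([X,Y],Z)=B(X,[Y,Z])$; an i-isomorphism is a Lie algebra isomorphism that preserves the forms, while an isomorphism is just a Lie algebra isomorphism. With $I(X,Y,Z)=B([X,Y],Z)$, $\mathfrak g$ is singular if it is non-Abelian and $\dim\{\alpha\in\mathfrak g^*\mid\alpha\wedge I=0\}\ge 1$. If $(\mathfrak q,B)$ is a space with a non-degenerate symmetric bilinear form and $C$ is a $B$-skew-symmetric endomorphism of $\mathfrak q$, the double extension of $\mathfrak q$ by $C$ is $\mathfrak q\oplus\mathbb{C}X_1\oplus\mathbb{C}Y_1$, where $X_1,Y_1$ are isotropic, orthogonal to $\mathfrak q$ and $B(X_1,Y_1)=1$, with bracket $$[X+\lambda X_1+\mu Y_1,\;Y+\lambda'X_1+\mu'Y_1]=\mu C(Y)-\mu'C(X)+B(C(X),Y)X_1\qquad(X,Y\in\mathfrak q).$$ The amalgamated product $\mathfrak g_1\times_{\mathrm a}\dots\times_{\mathrm a}\mathfrak g_k$ of the double extensions $\mathfrak g_i$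 of $\mathfrak q_i$ by $C_i$ is the double extension of the orthogonal direct sum $\bigoplus_i\mathfrak q_i$ by $\bigoplus_i C_i$. Let $J_p$ be the nilpotent $p\times p$ Jordan block with ones just above the diagonal. The nilpotent Jordan-type Lie algebra $\mathfrak j_{2p}$ ($p\ge 2$) is the double extension of $\mathbb{C}^{2p}$, with basis $E_1,\dots,E_p,F_1,\dots,F_p$ and form determined by $B(E_i,F_j)=\delta_{ij}$, $B(E_i,E_j)=B(F_i,F_j)=0$, by the map with matrix $\begin{pmatrix}J_p&0\\0&-{}^tJ_p\end{pmatrix}$. The nilpotent Jordan-type Lie algebra $\mathfrak j_{2p+1}$ ($p\ge 1$) is the double extension of $\mathbb{C}^{2p+1}$, with basis $E_1,\dots,E_p,G,F_1,\dots,F_p$ and form determined by $B(E_i,F_j)=\delta_{ij}$, $B(G,G)=1$, all other values being $0$, by the map with matrix $\begin{pmatrix}J_{p+1}&M\\0&-{}^tJ_p\end{pmatrix}$, where the only nonzero entry of the $(p+1)\times p$ matrix $M$ is $m_{p+1,p}=-1$. Put also $\mathfrak j_1:=$ the double extension of $\mathbb{C}$ (with $B(G,G)=1$) by $0$. For $n\ge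 1$ let $\mathcal P'(n)$ be the set of partitions of $n$, other than $(1,1,\dots,1)$, in which every even part occurs with even multiplicity. Write $[d]\in\mathcal P'(n)$ as $(p_1,p_1,\dots,p_k,p_k,2q_1+1,\dots,2q_\ell+1)$ with all $p_i$ even, $p_1\ge\dots\ge p_k$ and $q_1\ge\dots\ge q_\ell\ge 0$, and set $$\mathfrak g_{[d]}=\mathfrak j_{2p_1}\times_{\mathrm a}\dots\times_{\mathrm a}\mathfrak j_{2p_k}\times_{\mathrm a}\mathfrak j_{2q_1+1}\times_{\mathrm a}\dots\times_{\mathrm a}\mathfrak j_{2q_\ell+1}.$$ **Proposition 5.4.** Let $n\ge 1$. 1. For every $[d]\in\mathcal P'(n)$, $\mathfrak g_{[d]}$ is a nilpotent singular quadratic Lie algebra of dimension $n+2$, and the map $[d]\mapsto\mathfrak g_{[d]}$ induces a bijection from $\mathcal P'(n)$ onto the set of isomorphism classes of nilpotent singular quadratic Lie algebras of dimension $n+2$. 2. Every nilpotent singular quadratic Lie algebra of dimension $n+2$ is i-isomorphic to $\mathfrak g_{[d]}$ for a unique $[d]\in\mathcal P'(n)$. -/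

import Mathlib

universe u v

noncomputable section

/-! ### Quadratic Lie algebras, isomorphism, i-isomorphism -/

/-- A quadratic Lie algebra: a finite-dimensional complex Lie algebra equipped with a
non-degenerate symmetric bilinear form `form` such that `B([X,Y],Z) = B(X,[Y,Z])`. -/
structure QuadraticLieAlgebra : Type (u + 1) where
  carrier : Type u
  [lieRing : LieRing carrier]
  [lieAlgebra : LieAlgebra ℂ carrier]
  [finite : FiniteDimensional ℂ carrier]
  form : LinearMap.BilinForm ℂ carrier
  symm : form.IsSymm
  nondeg : form.Nondegenerate
  invariant : ∀ x y z : carrier, form ⁅x, y⁆ z = form x ⁅y, z⁆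

namespace QuadraticLieAlgebra

attribute [instance] lieRing lieAlgebra finite

/-- `g` and `g'` are isomorphic as Lie algebras (no compatibility of the forms is required). -/
def Isom (g : QuadraticLieAlgebra.{u}) (g' : QuadraticLieAlgebra.{v}) : Prop :=
  Nonempty (g.carrier ≃ₗ⁅ℂ⁆ g'.carrier)

/-- `g` and `g'` are i-isomorphic: there is an isometric Lie algebra isomorphism. -/
def IIsom (g : QuadraticLieAlgebra.{u}) (g' : QuadraticLieAlgebra.{v}) : Prop :=
  ∃ e : g.carrier ≃ₗ⁅ℂ⁆ g'.carrier, ∀ x y, g'.form (e x) (e y) = g.form x y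

theorem form_alternating (g : QuadraticLieAlgebra.{u}) (v : Fin 3 → g.carrier) (i j : Fin 3)
    (h : v i = v j) (hij : i ≠ j) : g.form ⁅v 0, v 1⁆ (v 2) = 0 := by
  have h01 : v 0 = v 1 → g.form ⁅v 0, v 1⁆ (v 2) = 0 := fun h => by rw [h]; simp
  have h12 : v 1 = v 2 → g.form ⁅v 0, v 1⁆ (v 2) = 0 := fun h => by
    rw [g.invariant, h]; simp
  have h02 : v 0 = v 2 → g.form ⁅v 0, v 1⁆ (v 2) = 0 := fun h => by
    rw [g.symm.eq, ← g.invariant, h]; simp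
  fin_cases i <;> fin_cases j <;> first
    | exact absurd rfl hij
    | exact h01 h
    | exact h12 h
    | exact h02 h
    | exact h01 h.symm
    | exact h12 h.symm
    | exact h02 h.symm

/-- The associated 3-form `I(X,Y,Z) = B([X,Y],Z)`. -/
def threeForm (g : QuadraticLieAlgebra.{u}) : g.carrier [⋀^Fin 3]→ₗ[ℂ] ℂ where
  toFun v := g.form ⁅v 0, v 1⁆ (v 2)
  map_update_add' := by
    have h01 : (0 : Fin 3) ≠ 1 := by decide
    have h02 : (0 : Fin 3) ≠ 2 := by decide
    have h12 : (1 : Fin 3) ≠ 2 := by decide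
    intro inst v i x y
    match i with
    | 0 => simp only [Function.update_self, Function.update_of_ne h01.symm,
        Function.update_of_ne h02.symm, add_lie, map_add, LinearMap.add_apply]
    | 1 => simp only [Function.update_self, Function.update_of_ne h01,
        Function.update_of_ne h12.symm, lie_add, map_add, LinearMap.add_apply]
    | 2 => simp only [Function.update_self, Function.update_of_ne h02,
        Function.update_of_ne h12, map_add]
  map_update_smul' := by
    have h01 : (0 : Fin 3) ≠ 1 := by decide
    have h02 : (0 : Fin 3) ≠ 2 := by decide
    have h12 : (1 : Fin 3) ≠ 2 := by decide
    intro inst v i c x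
    match i with
    | 0 => simp only [Function.update_self, Function.update_of_ne h01.symm,
        Function.update_of_ne h02.symm, smul_lie, map_smul, LinearMap.smul_apply]
    | 1 => simp only [Function.update_self, Function.update_of_ne h01,
        Function.update_of_ne h12.symm, lie_smul, map_smul, LinearMap.smul_apply]
    | 2 => simp only [Function.update_self, Function.update_of_ne h02,
        Function.update_of_ne h12, map_smul]
  map_eq_zero_of_eq' := fun v i j h hij => g.form_alternating v i j h hij

/-- The exterior product `α ∧ I` of a linear form and a 3-form, that is,
`(α ∧ I)(v₀,…,v₃) = ∑ᵢ (-1)ⁱ α(vᵢ) I(v₀,…,v̂ᵢ,…,v₃)`; it is linear in `α`. -/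
def wedgeThreeForm {V : Type u} [AddCommGroup V] [Module ℂ V] (I : V [⋀^Fin 3]→ₗ[ℂ] ℂ) :
    Module.Dual ℂ V →ₗ[ℂ] V [⋀^Fin 4]→ₗ[ℂ] ℂ where
  toFun α := AlternatingMap.alternatizeUncurryFin (LinearMap.smulRight α I)
  map_add' α β := by
    ext v
    simp [AlternatingMap.alternatizeUncurryFin_apply, add_mul, Finset.sum_add_distrib]
  map_smul' c α := by
    ext v
    simp [AlternatingMap.alternatizeUncurryFin_apply, Finset.mul_sum, mul_assoc, mul_left_comm]

/-- The dup-number: the dimension of `{α ∈ 𝔤* | α ∧ I = 0}`, with `I` the 3-form of `𝔤`. -/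
def dup (g : QuadraticLieAlgebra.{u}) : ℕ :=
  Module.finrank ℂ (LinearMap.ker (wedgeThreeForm g.threeForm))

/-- Singular: non-Abelian with `dup ≥ 1`. -/
def IsSingular (g : QuadraticLieAlgebra.{u}) : Prop :=
  ¬ IsLieAbelian g.carrier ∧ 1 ≤ g.dup

/-- `g` is a nilpotent singular quadratic Lie algebra of dimension `N`. -/
def IsNilpotentSingular (N : ℕ) (g : QuadraticLieAlgebra.{u}) : Prop :=
  Module.finrank ℂ g.carrier = N ∧ LieRing.IsNilpotent g.carrier ∧ g.IsSingular

/-- Isomorphism, as an equivalence relation on the nilpotent singular quadratic Lie algebras of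
dimension `N`. -/
instance nilpotentSingularSetoid (N : ℕ) :
    Setoid {g : QuadraticLieAlgebra.{u} // g.IsNilpotentSingular N} where
  r g g' := g.1.Isom g'.1
  iseqv := ⟨fun _ => ⟨LieEquiv.refl⟩, fun ⟨e⟩ => ⟨e.symm⟩, fun ⟨e⟩ ⟨f⟩ => ⟨e.trans f⟩⟩

/-- The isomorphism classes of nilpotent singular quadratic Lie algebras of dimension `N`. -/
def NilpotentSingularClasses (N : ℕ) : Type (u + 1) :=
  Quotient (nilpotentSingularSetoid.{u} N)

end QuadraticLieAlgebra

/-! ### Double extensions and amalgamated products -/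

/-- A quadratic vector space `(𝔮, B)` together with a `B`-skew-symmetric endomorphism `C`. -/
structure SkewQuadraticSpace where
  carrier : Type
  [addCommGroup : AddCommGroup carrier]
  [module : Module ℂ carrier]
  [finite : FiniteDimensional ℂ carrier]
  form : LinearMap.BilinForm ℂ carrier
  symm : form.IsSymm
  nondeg : form.Nondegenerate
  endo : carrier →ₗ[ℂ] carrier
  skew : ∀ x y, form (endo x) y = - form x (endo y)

namespace SkewQuadraticSpace

attribute [instance] addCommGroup module finite

/-- The underlying space `𝔮 ⊕ ℂ X₁ ⊕ ℂ Y₁` of the double extension; the element with components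
`q`, `x`, `y` is `q + x X₁ + y Y₁`. -/
@[ext]
structure Ext (D : SkewQuadraticSpace) : Type where
  q : D.carrier
  x : ℂ
  y : ℂ

namespace Ext

variable {D : SkewQuadraticSpace}

/-- The identification of `𝔮 ⊕ ℂ X₁ ⊕ ℂ Y₁` with a product; the vector space structure is
transported along it, so it is componentwise. -/
def equivProd (D : SkewQuadraticSpace) : D.Ext ≃ D.carrier × ℂ × ℂ where
  toFun u := (u.q, u.x, u.y)
  invFun p := ⟨p.1, p.2.1, p.2.2⟩
  left_inv _ := rfl
  right_inv _ := rfl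

instance : AddCommGroup D.Ext := (equivProd D).addCommGroup

instance : Module ℂ D.Ext := (equivProd D).module ℂ

instance : FiniteDimensional ℂ D.Ext :=
  Module.Finite.equiv ((equivProd D).linearEquiv ℂ).symm

@[simp] theorem add_q (u v : D.Ext) : (u + v).q = u.q + v.q := rfl
@[simp] theorem add_x (u v : D.Ext) : (u + v).x = u.x + v.x := rfl
@[simp] theorem add_y (u v : D.Ext) : (u + v).y = u.y + v.y := rfl
@[simp] theorem smul_q (c : ℂ) (u : D.Ext) : (c • u).q = c • u.q := rfl
@[simp] theorem smul_x (c : ℂ) (u : D.Ext) : (c • u).x = c * u.x := rfl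
@[simp] theorem smul_y (c : ℂ) (u : D.Ext) : (c • u).y = c * u.y := rfl
@[simp] theorem zero_q : (0 : D.Ext).q = 0 := rfl
@[simp] theorem zero_x : (0 : D.Ext).x = 0 := rfl
@[simp] theorem zero_y : (0 : D.Ext).y = 0 := rfl

/-- `[X + x X₁ + y Y₁, X' + x' X₁ + y' Y₁] = y C(X') - y' C(X) + B(C(X), X') X₁`. -/
instance : Bracket D.Ext D.Ext where
  bracket u v := ⟨u.y • D.endo v.q - v.y • D.endo u.q, D.form (D.endo u.q) v.q, 0⟩

@[simp] theorem lie_q (u v : D.Ext) : ⁅u, v⁆.q = u.y • D.endo v.q - v.y • D.endo u.q := rfl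
@[simp] theorem lie_x (u v : D.Ext) : ⁅u, v⁆.x = D.form (D.endo u.q) v.q := rfl
@[simp] theorem lie_y (u v : D.Ext) : ⁅u, v⁆.y = 0 := rfl

end Ext

theorem form_comm (D : SkewQuadraticSpace) (x y : D.carrier) : D.form x y = D.form y x :=
  D.symm.eq x y

theorem form_endo_self (D : SkewQuadraticSpace) (x : D.carrier) : D.form (D.endo x) x = 0 := by
  have h := D.skew x x
  rw [D.form_comm x] at h
  exact self_eq_neg.mp h

instance (D : SkewQuadraticSpace) : LieRing D.Ext where
  add_lie u v w := by
    ext <;> simp only [Ext.lie_q, Ext.lie_x, Ext.lie_y, Ext.add_q, Ext.add_x, Ext.add_y, map_add,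
      LinearMap.add_apply, add_zero]
    module
  lie_add u v w := by
    ext <;> simp only [Ext.lie_q, Ext.lie_x, Ext.lie_y, Ext.add_q, Ext.add_x, Ext.add_y, map_add,
      add_zero]
    module
  lie_self u := by
    ext <;> simp [form_endo_self]
  leibniz_lie u v w := by
    have h2 := D.skew (D.endo u.q) w.q
    have h3 := D.skew (D.endo v.q) w.q
    have e1 := D.form_comm (D.endo v.q) (D.endo u.q)
    ext
    · simp only [Ext.lie_q, Ext.lie_y, Ext.add_q, map_sub, map_smul]
      module
    · simp [h2, h3, e1]
      ring
    · simp

instance (D : SkewQuadraticSpace) : LieAlgebra ℂ D.Ext where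
  lie_smul c u v := by
    ext <;> simp only [Ext.lie_q, Ext.lie_x, Ext.lie_y, Ext.smul_q, Ext.smul_x, Ext.smul_y,
      map_smul, smul_eq_mul, mul_zero]
    module

/-- The form `B + B_𝔱` with `B_𝔱(X₁,X₁) = B_𝔱(Y₁,Y₁) = 0`, `B_𝔱(X₁,Y₁) = 1`. -/
def extForm (D : SkewQuadraticSpace) : LinearMap.BilinForm ℂ D.Ext :=
  LinearMap.mk₂ ℂ (fun u v => D.form u.q v.q + u.x * v.y + u.y * v.x)
    (fun u u' v => by simp; ring) (fun c u v => by simp; ring)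
    (fun u v v' => by simp; ring) (fun c u v => by simp; ring)

theorem extForm_apply (D : SkewQuadraticSpace) (u v : D.Ext) :
    D.extForm u v = D.form u.q v.q + u.x * v.y + u.y * v.x := rfl

theorem extForm_comm (D : SkewQuadraticSpace) (u v : D.Ext) : D.extForm u v = D.extForm v u := by
  rw [extForm_apply, extForm_apply, D.form_comm]; ring

theorem extForm_nondeg (D : SkewQuadraticSpace) : D.extForm.Nondegenerate := by
  have key : ∀ u : D.Ext, (∀ v, D.extForm u v = 0) → u = 0 := by
    intro u hu
    ext
    · refine D.nondeg.1 _ fun y => ?_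
      simpa [extForm_apply] using hu ⟨y, 0, 0⟩
    · simpa [extForm_apply] using hu ⟨0, 0, 1⟩
    · simpa [extForm_apply] using hu ⟨0, 1, 0⟩
  exact ⟨key, fun v hv => key v fun u => (D.extForm_comm v u).trans (hv u)⟩

/-- The double extension of `(𝔮, B)` by the skew-symmetric map `C`. -/
def doubleExtension (D : SkewQuadraticSpace) : QuadraticLieAlgebra.{0} where
  carrier := D.Ext
  form := D.extForm
  symm := ⟨D.extForm_comm⟩
  nondeg := D.extForm_nondeg
  invariant u v w := by
    have h1 := D.skew u.q w.q
    have h2 := D.skew u.q v.q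
    simp only [extForm_apply, Ext.lie_q, Ext.lie_x, Ext.lie_y, map_sub, map_smul,
      LinearMap.sub_apply, LinearMap.smul_apply, smul_eq_mul, h1, h2]
    ring

/-- The orthogonal direct sum of a finite family `(𝔮ᵢ, Bᵢ, Cᵢ)`, with `B = ∑ Bᵢ` and
`C = ⨁ Cᵢ`. -/
def directSum {ι : Type} [Fintype ι] (D : ι → SkewQuadraticSpace) : SkewQuadraticSpace where
  carrier := ∀ i, (D i).carrier
  form := ∑ i, (D i).form.compl₁₂ (LinearMap.proj i) (LinearMap.proj i)
  symm := ⟨fun x y => by simpa using Finset.sum_congr rfl fun i _ => (D i).symm.eq (x i) (y i)⟩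
  nondeg := by
    classical
    have key : ∀ x : ∀ i, (D i).carrier,
        (∀ y, (∑ i, (D i).form.compl₁₂ (LinearMap.proj i) (LinearMap.proj i) :
          LinearMap.BilinForm ℂ (∀ i, (D i).carrier)) x y = 0) → x = 0 := by
      intro x hx
      funext i
      refine (D i).nondeg.1 _ fun y => ?_
      have := hx (Pi.single i y)
      simp only [LinearMap.coe_sum, Finset.sum_apply, LinearMap.compl₁₂_apply,
        LinearMap.proj_apply] at this
      rw [Finset.sum_eq_single i (fun j _ hj => by simp [Pi.single_eq_of_ne hj]) (by simp)] at this
      simpa using this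
    refine ⟨key, fun y hy => key y fun x => ?_⟩
    have := hy x
    simp only [LinearMap.coe_sum, Finset.sum_apply, LinearMap.compl₁₂_apply,
      LinearMap.proj_apply] at this ⊢
    rw [← this]
    exact Finset.sum_congr rfl fun i _ => (D i).symm.eq (y i) (x i)
  endo := LinearMap.pi fun i => (D i).endo ∘ₗ LinearMap.proj i
  skew x y := by simp [(D _).skew, Finset.sum_neg_distrib]

/-- The amalgamated product of the double extensions of `(𝔮ᵢ, Bᵢ)` by `Cᵢ`: the double extension of
the orthogonal direct sum `⨁ 𝔮ᵢ` by `⨁ Cᵢ`. -/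
def amalgamatedProduct {ι : Type} [Fintype ι] (D : ι → SkewQuadraticSpace) :
    QuadraticLieAlgebra.{0} :=
  (directSum D).doubleExtension

/-! ### Nilpotent Jordan-type Lie algebras -/

/-- The space `ℂ^ι` with the bilinear form of Gram matrix `S` and the endomorphism of matrix `A` in
the canonical basis. -/
def ofMatrix {ι : Type} [Fintype ι] [DecidableEq ι] (S A : Matrix ι ι ℂ) (hS : S.transpose = S)
    (hSS : S * S = 1) (hA : A.transpose * S = -(S * A)) : SkewQuadraticSpace where
  carrier := ι → ℂ
  form := Matrix.toBilin' S
  symm := ⟨fun x y => by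
    simp only [Matrix.toBilin'_apply']
    rw [Matrix.dotProduct_mulVec, ← Matrix.mulVec_transpose, hS, dotProduct_comm]⟩
  nondeg := Matrix.Nondegenerate.toBilin'
    (Matrix.nondegenerate_of_det_ne_zero fun h => by
      have := congrArg Matrix.det hSS
      simp [h] at this)
  endo := Matrix.toLin' A
  skew x y := by
    simp only [Matrix.toBilin'_apply', Matrix.toLin'_apply]
    rw [Matrix.mulVec_mulVec, ← dotProduct_neg, ← Matrix.neg_mulVec, ← hA, ← Matrix.mulVec_mulVec,
      Matrix.dotProduct_mulVec x, Matrix.vecMul_transpose]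

/-- The nilpotent Jordan block `J_p` of size `p`, with ones just above the diagonal. -/
def jordanBlock (p : ℕ) : Matrix (Fin p) (Fin p) ℂ :=
  Matrix.of fun i j => if (i : ℕ) + 1 = j then 1 else 0

/-- Gram matrix of the canonical bilinear form of `ℂ^(2p)` in the canonical basis
`E_1,…,E_p,F_1,…,F_p`: `B(E_i,F_j) = δ_ij`, `B(E_i,E_j) = B(F_i,F_j) = 0`. -/
def gramEven (p : ℕ) : Matrix (Fin p ⊕ Fin p) (Fin p ⊕ Fin p) ℂ :=
  Matrix.fromBlocks 0 1 1 0

/-- The matrix with diagonal blocks `J_p` and `-ᵗJ_p`. -/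
def endoEven (p : ℕ) : Matrix (Fin p ⊕ Fin p) (Fin p ⊕ Fin p) ℂ :=
  Matrix.fromBlocks (jordanBlock p) 0 0 (-(jordanBlock p).transpose)

/-- `ℂ^(2p)` with its canonical bilinear form and the skew-symmetric map `C^J_(2p)`. -/
def jordanEven (p : ℕ) : SkewQuadraticSpace :=
  ofMatrix (gramEven p) (endoEven p)
    (by simp [gramEven, Matrix.fromBlocks_transpose])
    (by simp [gramEven, Matrix.fromBlocks_multiply])
    (by simp [gramEven, endoEven, Matrix.fromBlocks_multiply, Matrix.fromBlocks_transpose,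
          Matrix.fromBlocks_neg])

/-- The Gram matrix of the pairing between `E_1,…,E_p,G` and `F_1,…,F_p`. -/
def pairingOdd (p : ℕ) : Matrix (Fin (p + 1)) (Fin p) ℂ :=
  Matrix.of fun i j => if (i : ℕ) = j then 1 else 0

/-- Gram matrix of the canonical bilinear form of `ℂ^(2p+1)` in the canonical basis
`E_1,…,E_p,G,F_1,…,F_p`: `B(E_i,F_j) = δ_ij`, `B(G,G) = 1`, and the other values are zero. The
vectors `E_1,…,E_p,G` are indexed by the first summand `Fin (p + 1)`. -/
def gramOdd (p : ℕ) : Matrix (Fin (p + 1) ⊕ Fin p) (Fin (p + 1) ⊕ Fin p) ℂ :=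
  Matrix.fromBlocks (Matrix.single (Fin.last p) (Fin.last p) 1) (pairingOdd p)
    (pairingOdd p).transpose 0

/-- The matrix with blocks `J_(p+1)`, `M`, `0`, `-ᵗJ_p`, where the only nonzero entry of the
`(p+1) × p` matrix `M` is `-1`, in the last row and the last column. -/
def endoOdd (p : ℕ) : Matrix (Fin (p + 1) ⊕ Fin p) (Fin (p + 1) ⊕ Fin p) ℂ :=
  Matrix.fromBlocks (jordanBlock (p + 1))
    (Matrix.of fun i j => if (i : ℕ) = p ∧ (j : ℕ) + 1 = p then -1 else 0)
    0 (-(jordanBlock p).transpose)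

theorem gramOdd_transpose (p : ℕ) : (gramOdd p).transpose = gramOdd p := by
  simp [gramOdd, Matrix.fromBlocks_transpose]

theorem sum_ite_val {n : ℕ} (m : ℕ) (f : Fin n → ℂ) :
    (∑ j : Fin n, if (j : ℕ) = m then f j else 0) = if h : m < n then f ⟨m, h⟩ else 0 := by
  split_ifs with h
  · rw [Finset.sum_eq_single ⟨m, h⟩] <;> simp +contextual [Fin.ext_iff]
  · exact Finset.sum_eq_zero fun j _ => if_neg (by omega)

theorem sum_ite_val' {n : ℕ} (m : ℕ) (f : Fin n → ℂ) :
    (∑ j : Fin n, if m = (j : ℕ) then f j else 0) = if h : m < n then f ⟨m, h⟩ else 0 := by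
  simp only [eq_comm (a := m), sum_ite_val]

theorem sum_ite_val_succ {n : ℕ} (m : ℕ) (f : Fin n → ℂ) :
    (∑ j : Fin n, if (j : ℕ) + 1 = m then f j else 0) =
      if h : 0 < m ∧ m - 1 < n then f ⟨m - 1, h.2⟩ else 0 := by
  split_ifs with h
  · rw [← dif_pos (c := m - 1 < n) (t := fun h => f ⟨m - 1, h⟩) (e := fun _ => 0) h.2,
      ← sum_ite_val]
    exact Finset.sum_congr rfl fun j _ => by congr 1; apply propext; omega
  · exact Finset.sum_eq_zero fun j _ => if_neg (by omega)

theorem gramOdd_mul_self (p : ℕ) : gramOdd p * gramOdd p = 1 := by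
  rw [gramOdd, Matrix.fromBlocks_multiply, ← Matrix.fromBlocks_one]
  congr 1 <;> ext i j <;>
    simp [Matrix.mul_apply, pairingOdd, Matrix.single_apply, Matrix.one_apply, Fin.ext_iff,
      ite_and, sum_ite_val, sum_ite_val'] <;>
    grind

theorem endoOdd_skew (p : ℕ) :
    (endoOdd p).transpose * gramOdd p = -(gramOdd p * endoOdd p) := by
  rw [gramOdd, endoOdd, Matrix.fromBlocks_transpose, Matrix.fromBlocks_multiply,
    Matrix.fromBlocks_multiply, Matrix.fromBlocks_neg]
  congr 1 <;> ext i j <;>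
    simp [Matrix.mul_apply, pairingOdd, Matrix.single_apply, jordanBlock, Fin.ext_iff,
      ite_and, sum_ite_val, sum_ite_val', sum_ite_val_succ] <;>
    grind

/-- `ℂ^(2p+1)` with its canonical bilinear form and the skew-symmetric map `C^J_(2p+1)`. For
`p = 0` it is the line `ℂ` with the zero map. -/
def jordanOdd (p : ℕ) : SkewQuadraticSpace :=
  ofMatrix (gramOdd p) (endoOdd p) (gramOdd_transpose p) (gramOdd_mul_self p) (endoOdd_skew p)

/-- The nilpotent Jordan-type Lie algebra `𝔧_(2p)` (used for `p ≥ 2`). -/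
def jordanLieEven (p : ℕ) : QuadraticLieAlgebra.{0} := (jordanEven p).doubleExtension

/-- The nilpotent Jordan-type Lie algebra `𝔧_(2p+1)` (for `p ≥ 1`; for `p = 0` it is the Abelian
double extension of the line by the zero map). -/
def jordanLieOdd (p : ℕ) : QuadraticLieAlgebra.{0} := (jordanOdd p).doubleExtension

end SkewQuadraticSpace

/-! ### Special partitions and the associated Lie algebras -/

/-- The partitions of `n` in which every even part occurs with even multiplicity, other than the
partition `(1,…,1)`, for which the associated skew-symmetric map is zero. -/
def SpecialPartition (n : ℕ) : Type :=
  {d : n.Partition // (∀ m ∈ d.parts, Even m → Even (d.parts.count m)) ∧ ∃ m ∈ d.parts, m ≠ 1}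

namespace SpecialPartition

variable {n : ℕ}

/-- Writing `d = (p₁,p₁,…,p_k,p_k,2q₁+1,…,2q_l+1)` with `p₁ ≥ … ≥ p_k` even, the list
`[p₁,…,p_k]`: each even part is repeated half as many times as it occurs in `d`. -/
def evenParts (d : SpecialPartition n) : List ℕ :=
  ((d.1.parts.toFinset.filter Even).sort (· ≥ ·)).flatMap fun m =>
    List.replicate (d.1.parts.count m / 2) m

/-- Writing `d = (p₁,p₁,…,p_k,p_k,2q₁+1,…,2q_l+1)` with `q₁ ≥ … ≥ q_l`, the list
`[q₁,…,q_l]`. -/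
def oddParts (d : SpecialPartition n) : List ℕ :=
  ((d.1.parts.filter Odd).sort (· ≥ ·)).map fun m => m / 2

/-- The list `C^J_(2p₁),…,C^J_(2p_k),C^J_(2q₁+1),…,C^J_(2q_l+1)` of the blocks of `C_[d]`. -/
def blocks (d : SpecialPartition n) : List SkewQuadraticSpace :=
  d.evenParts.map SkewQuadraticSpace.jordanEven ++ d.oddParts.map SkewQuadraticSpace.jordanOdd

/-- The quadratic Lie algebra `𝔤_[d]`: the amalgamated product
`𝔧_(2p₁) ×ₐ … ×ₐ 𝔧_(2p_k) ×ₐ 𝔧_(2q₁+1) ×ₐ … ×ₐ 𝔧_(2q_l+1)`. -/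
def lieAlgebra (d : SpecialPartition n) : QuadraticLieAlgebra.{0} :=
  SkewQuadraticSpace.amalgamatedProduct d.blocks.get

end SpecialPartition

end

/-! ### Special partitions -/

/-! The problem reduces to nilpotent skew-symmetric maps C on quadratic spaces, where the Jordan
type is a complete invariant.

Existence. Write a form α ≠ 0 with α ∧ I = 0 as B(x, ·). Such x form an ideal, so nilpotency gives a
nonzero central X in it (`exists_central`). Evaluating B(X, ·) ∧ I = 0 shows that X is isotropic,
since 𝔤 is not Abelian, and that [b, c] = B([Y, b], c) X on X^⊥, for an isotropic Y with B(X, Y) = 1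
(`exists_splitting`). Hence 𝔤 is the double extension of {X, Y}^⊥ by the restriction C of ad Y. If
C^m is the last nonzero power, B(x, C^m y) is a nonzero form, symmetric or alternating with the
parity of m. A vector (m even) or a pair (m odd) on which it does not vanish can be corrected by
powers of C until it spans a copy of a standard block; this copy is non-degenerate, and induction
applies to its orthogonal complement (`exists_embedsOrthogonally`).

Uniqueness. For k ≥ 1 and C ≠ 0, the maximal rank of (ad u)^k over the double extension is the rank
of C^k, attained at Y₁ (`finrank_range_ad_pow_le`, `finrank_range_endo_pow_le_ad_pow`). A Lie
isomorphism therefore preserves these ranks, whatever it does to the forms. For C_[d] they are the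
sums of the truncated differences m - k over the parts m of d, which determine d. So isomorphic
algebras have equal partitions, which settles injectivity for isomorphism and for i-isomorphism at
once. -/

/-- As a function of k, the truncated difference a - k is convex with its only kink at k = a, so its
second difference centred at k + 1 detects a = k + 1. -/
theorem Multiset.sum_map_sub_second_difference (s : Multiset ℕ) (k : ℕ) :
    (s.map (· - k)).sum + (s.map (· - (k + 2))).sum =
      2 * (s.map (· - (k + 1))).sum + s.count (k + 1) := by
  induction s using Multiset.induction_on with
  | empty => simp
  | cons a s ih =>
    simp only [Multiset.map_cons, Multiset.sum_cons, Multiset.count_cons]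
    split_ifs <;> omega

/-- Second differences recover the multiplicity of every positive entry; zeros contribute to no sum
and have to be excluded. -/
theorem Multiset.eq_of_sum_map_sub_eq {s t : Multiset ℕ} (hs : 0 ∉ s) (ht : 0 ∉ t)
    (h : ∀ k, (s.map (· - k)).sum = (t.map (· - k)).sum) : s = t := by
  ext m
  cases m with
  | zero => rw [Multiset.count_eq_zero_of_notMem hs, Multiset.count_eq_zero_of_notMem ht]
  | succ k =>
    have h1 := s.sum_map_sub_second_difference k
    have h2 := t.sum_map_sub_second_difference k
    rw [h, h, h] at h1
    omega

namespace SpecialPartition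

variable {n : ℕ}

theorem zero_notMem_parts (d : SpecialPartition n) : 0 ∉ d.1.parts :=
  fun h => (d.1.parts_pos h).ne' rfl

theorem evenParts_add_evenParts (d : SpecialPartition n) :
    (d.evenParts : Multiset ℕ) + (d.evenParts : Multiset ℕ) = d.1.parts.filter Even := by
  ext m
  have key : d.evenParts.count m = if Even m then d.1.parts.count m / 2 else 0 := by
    rw [evenParts, List.count_flatMap]
    have : ∀ s : Finset ℕ, ((s.sort (· ≥ ·)).map
        (List.count m ∘ fun a => List.replicate (d.1.parts.count a / 2) a)).sum =
        ∑ a ∈ s, if a = m then d.1.parts.count a / 2 else 0 := by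
      intro s
      rw [← Multiset.sum_coe, ← Multiset.map_coe, Finset.sort_eq]
      refine congrArg Multiset.sum (Multiset.map_congr rfl fun a _ => ?_)
      simp [List.count_replicate]
    rw [this, Finset.sum_ite_eq']
    simp only [Finset.mem_filter, Multiset.mem_toFinset]
    by_cases hm : m ∈ d.1.parts
    · simp [hm]
    · simp [hm]
  rw [Multiset.count_add, Multiset.coe_count, key, Multiset.count_filter]
  split_ifs with h
  · by_cases hm : m ∈ d.1.parts
    · have := d.2.1 m hm h
      obtain ⟨r, hr⟩ := this
      omega
    · simp [hm]
  · rfl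

theorem oddParts_map (d : SpecialPartition n) :
    (d.oddParts : Multiset ℕ).map (fun q => 2 * q + 1) = d.1.parts.filter Odd := by
  rw [oddParts, ← Multiset.map_coe, Multiset.sort_eq, Multiset.map_map]
  conv_rhs => rw [← Multiset.map_id (d.1.parts.filter Odd)]
  refine Multiset.map_congr rfl fun m hm => ?_
  have := Nat.odd_iff.mp (Multiset.mem_filter.mp hm).2
  simp only [Function.comp_apply, id]
  omega

theorem parts_eq (d : SpecialPartition n) :
    d.1.parts = (d.evenParts : Multiset ℕ) + (d.evenParts : Multiset ℕ) +
      (d.oddParts : Multiset ℕ).map (fun q => 2 * q + 1) := by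
  rw [evenParts_add_evenParts, oddParts_map]
  conv_lhs => rw [← Multiset.filter_add_not Even d.1.parts]
  simp only [Nat.not_even_iff_odd]

/-- Turns the block sizes produced by the decomposition into a special partition. Agreement is only
up to order because the lists attached to a partition are sorted. -/
theorem exists_of_lists (evens odds : List ℕ) (heven : ∀ p ∈ evens, Even p ∧ 0 < p)
    (hsum : 2 * evens.sum + (odds.map fun q => 2 * q + 1).sum = n)
    (hne : evens ≠ [] ∨ ∃ q ∈ odds, q ≠ 0) :
    ∃ d : SpecialPartition n, d.evenParts.Perm evens ∧ d.oddParts.Perm odds := by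
  classical
  set s : Multiset ℕ := (evens : Multiset ℕ) + (evens : Multiset ℕ) +
    (odds : Multiset ℕ).map fun q => 2 * q + 1 with hs
  have hodd : ∀ m ∈ (odds : Multiset ℕ).map (fun q => 2 * q + 1), ¬ Even m := by
    intro m hm
    obtain ⟨q, -, rfl⟩ := Multiset.mem_map.mp hm
    simp
  have hfe : s.filter Even = (evens : Multiset ℕ) + (evens : Multiset ℕ) := by
    rw [hs, Multiset.filter_add, Multiset.filter_eq_nil.mpr hodd, add_zero,
      Multiset.filter_eq_self]
    intro a ha
    simp only [Multiset.mem_add, Multiset.mem_coe, or_self] at ha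
    exact (heven a ha).1
  have hfo : s.filter Odd = (odds : Multiset ℕ).map fun q => 2 * q + 1 := by
    rw [hs, Multiset.filter_add, Multiset.filter_eq_self.mpr
      (fun a ha => Nat.not_even_iff_odd.mp (hodd a ha)), Multiset.filter_eq_nil.mpr, zero_add]
    intro a ha
    simp only [Multiset.mem_add, Multiset.mem_coe, or_self] at ha
    exact Nat.not_odd_iff_even.mpr (heven a ha).1
  have hpos : ∀ {i}, i ∈ s → 0 < i := by
    intro i hi
    simp only [hs, Multiset.mem_add, Multiset.mem_coe, or_self, Multiset.mem_map] at hi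
    rcases hi with hi | ⟨q, -, rfl⟩
    · exact (heven i hi).2
    · omega
  have hsum' : s.sum = n := by
    simp only [hs, Multiset.sum_add, Multiset.map_coe, Multiset.sum_coe]
    omega
  let d : SpecialPartition n := ⟨⟨s, hpos, hsum'⟩, by
    refine ⟨fun m hm h => ?_, ?_⟩
    · change Even (s.count m)
      have : s.count m = (s.filter Even).count m := by rw [Multiset.count_filter, if_pos h]
      rw [this, hfe, Multiset.count_add]
      exact ⟨_, rfl⟩
    · change ∃ m ∈ s, m ≠ 1
      rcases hne with h | ⟨q, hq, hq0⟩
      · obtain ⟨p, hp⟩ := List.exists_mem_of_ne_nil _ h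
        refine ⟨p, by simp [hs, hp], ?_⟩
        rintro rfl
        exact absurd (heven 1 hp).1 (by decide)
      · exact ⟨2 * q + 1, by simp [hs, hq], by omega⟩⟩
  refine ⟨d, ?_, ?_⟩
  · rw [← Multiset.coe_eq_coe]
    have h : (d.evenParts : Multiset ℕ) + (d.evenParts : Multiset ℕ) =
        (evens : Multiset ℕ) + (evens : Multiset ℕ) :=
      d.evenParts_add_evenParts.trans hfe
    ext m
    have := congrArg (Multiset.count m) h
    simp only [Multiset.count_add] at this
    omega
  · rw [← Multiset.coe_eq_coe]
    have h : (d.oddParts : Multiset ℕ).map (fun q => 2 * q + 1) = _ := d.oddParts_map.trans hfo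
    exact Multiset.map_injective (fun a b h => by simpa using h) h

end SpecialPartition

/-! ### Ranks of the powers of the standard nilpotent maps -/

/-- Spanning chains of the right total length form a basis by counting. Then f^k shifts each chain
by k places, so its range has as basis the members at depth at least k. -/
theorem LinearMap.finrank_range_pow_of_chains {K V α : Type*} [Field K] [AddCommGroup V]
    [Module K V] [FiniteDimensional K V] [Fintype α] (f : V →ₗ[K] V) (len : α → ℕ) (x : α → V)
    (h0 : ∀ a, (f ^ len a) (x a) = 0)
    (hspan : ⊤ ≤ Submodule.span K (Set.range fun p : Σ a, Fin (len a) => (f ^ (p.2 : ℕ)) (x p.1)))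
    (hcard : ∑ a, len a = Module.finrank K V) (k : ℕ) :
    Module.finrank K (LinearMap.range (f ^ k)) = ∑ a, (len a - k) := by
  have li : LinearIndependent K fun p : Σ a, Fin (len a) => (f ^ (p.2 : ℕ)) (x p.1) :=
    linearIndependent_of_top_le_span_of_card_eq_finrank hspan (by simpa using hcard)
  let g : (Σ a, Fin (len a - k)) → Σ a, Fin (len a) := fun p => ⟨p.1, ⟨p.2 + k, by omega⟩⟩
  have hg : Function.Injective g := by
    rintro ⟨a, i⟩ ⟨b, j⟩ h
    simp only [g, Sigma.mk.injEq] at h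
    obtain ⟨rfl, h⟩ := h
    simp only [heq_eq_eq, Fin.mk.injEq, add_left_inj] at h
    rw [Fin.ext h]
  have li' := li.comp g hg
  have hrange : LinearMap.range (f ^ k) = Submodule.span K (Set.range
      ((fun p : Σ a, Fin (len a) => (f ^ (p.2 : ℕ)) (x p.1)) ∘ g)) := by
    rw [LinearMap.range_eq_map, ← top_le_iff.mp hspan, Submodule.map_span]
    apply le_antisymm
    · rw [Submodule.span_le]
      rintro _ ⟨_, ⟨⟨a, i⟩, rfl⟩, rfl⟩
      by_cases hi : (i : ℕ) + k < len a
      · refine Submodule.subset_span ⟨⟨a, ⟨i, by omega⟩⟩, ?_⟩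
        simp only [g, Function.comp_apply]
        rw [← Module.End.mul_apply, ← pow_add, add_comm]
      · have : (f ^ k) ((f ^ (i : ℕ)) (x a)) = 0 := by
          rw [← Module.End.mul_apply, ← pow_add,
            show k + (i : ℕ) = (k + i - len a) + len a by omega, pow_add, Module.End.mul_apply,
            h0, map_zero]
        simp only [this, SetLike.mem_coe, Submodule.zero_mem]
    · rw [Submodule.span_le]
      rintro _ ⟨⟨a, i⟩, rfl⟩
      refine Submodule.subset_span ⟨_, ⟨⟨a, ⟨i, by omega⟩⟩, rfl⟩, ?_⟩
      simp only [g, Function.comp_apply]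
      rw [← Module.End.mul_apply, ← pow_add, add_comm]
  rw [hrange, finrank_span_eq_card li', Fintype.card_sigma]
  simp

theorem LinearMap.pow_apply_of_shift {K V : Type*} [Semiring K] [AddCommMonoid V] [Module K V]
    (f : V →ₗ[K] V) (e : ℕ → V) (N : ℕ) (he : ∀ i < N, f (e (i + 1)) = e i) (j : ℕ) (hj : j ≤ N) :
    (f ^ j) (e N) = e (N - j) := by
  induction j with
  | zero => rfl
  | succ j ih =>
    rw [pow_succ', Module.End.mul_apply, ih (by omega), show N - j = N - (j + 1) + 1 by omega,
      he _ (by omega)]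

/-! ### Jordan chains of the standard blocks and ranks in direct sums -/

namespace SkewQuadraticSpace

theorem top_le_span_of_single {ι : Type} [Fintype ι] [DecidableEq ι] (s : Set (ι → ℂ))
    (h : ∀ i, ∃ c : ℂ, c ≠ 0 ∧ c • Pi.single i (1 : ℂ) ∈ s) : ⊤ ≤ Submodule.span ℂ s := by
  rw [← (Pi.basisFun ℂ ι).span_eq, Submodule.span_le]
  rintro _ ⟨i, rfl⟩
  obtain ⟨c, hc, hs⟩ := h i
  have := Submodule.smul_mem _ c⁻¹ (Submodule.subset_span (R := ℂ) hs)
  rw [inv_smul_smul₀ hc] at this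
  simpa using this

/-- The chain `E_1, …, E_p, G, -F_p, F_(p-1), …` in `ℂ^(2p+1)`. -/
def oddChain (p i : ℕ) : Fin (p + 1) ⊕ Fin p → ℂ :=
  Sum.elim (fun a => if (a : ℕ) = i then 1 else 0)
    (fun b => if (b : ℕ) + i = 2 * p then (-1) ^ (i - p) else 0)

theorem endoOdd_mulVec_inl (p : ℕ) (f : Fin (p + 1) → ℂ) (g : Fin p → ℂ) (a : Fin (p + 1)) :
    Matrix.toLin' (endoOdd p) (Sum.elim f g) (Sum.inl a) =
      (if h : (a : ℕ) + 1 < p + 1 then f ⟨a + 1, h⟩ else 0) -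
        if h : (a : ℕ) = p ∧ 0 < p then g ⟨p - 1, by omega⟩ else 0 := by
  by_cases ha : (a : ℕ) = p
  · by_cases hp : 0 < p
    · simp [endoOdd, Matrix.mulVec, dotProduct, jordanBlock, sum_ite_val', sum_ite_val_succ, ha,
        ← sub_eq_add_neg, hp]
    · obtain rfl : p = 0 := by omega
      simp [endoOdd, Matrix.mulVec, dotProduct, jordanBlock]
  · simp [endoOdd, Matrix.mulVec, dotProduct, jordanBlock, sum_ite_val', ha]

theorem endoOdd_mulVec_inr (p : ℕ) (f : Fin (p + 1) → ℂ) (g : Fin p → ℂ) (b : Fin p) :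
    Matrix.toLin' (endoOdd p) (Sum.elim f g) (Sum.inr b) =
      -if h : 0 < (b : ℕ) then g ⟨b - 1, by omega⟩ else 0 := by
  simp [endoOdd, Matrix.mulVec, dotProduct, jordanBlock, sum_ite_val_succ]
  grind

theorem endoOdd_oddChain_succ (p i : ℕ) (hi : i < 2 * p) :
    Matrix.toLin' (endoOdd p) (oddChain p (i + 1)) = oddChain p i := by
  have hpow : p ≤ i → i + 1 - p = i - p + 1 := by omega
  ext (a | b)
  · rw [oddChain, endoOdd_mulVec_inl]
    simp only [oddChain, Sum.elim_inl]
    have : p ≤ i ∨ i + 1 ≤ p := by omega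
    split_ifs <;> first | omega | simp
    -- The case left is i = p, where the entry -1 of the off-diagonal block sends -F_p to G.
    rw [show i + 1 - p = 1 by omega]; simp
  · rw [oddChain, endoOdd_mulVec_inr]
    simp only [oddChain, Sum.elim_inr]
    split_ifs <;> first | omega | skip
    · rw [hpow (by omega), pow_succ]; ring
    · simp
    · simp

theorem endoOdd_oddChain_zero (p : ℕ) :
    Matrix.toLin' (endoOdd p) (oddChain p 0) = 0 := by
  ext (a | b)
  · rw [oddChain, endoOdd_mulVec_inl]
    simp only [Pi.zero_apply]
    split_ifs <;> grind
  · rw [oddChain, endoOdd_mulVec_inr]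
    simp only [Pi.zero_apply]
    split_ifs <;> first | omega | simp

theorem finrank_range_endoOdd (p k : ℕ) :
    Module.finrank ℂ (LinearMap.range (Matrix.toLin' (endoOdd p) ^ k)) = 2 * p + 1 - k := by
  have hpow := LinearMap.pow_apply_of_shift (Matrix.toLin' (endoOdd p)) (oddChain p) (2 * p)
    (endoOdd_oddChain_succ p)
  have := LinearMap.finrank_range_pow_of_chains (α := Unit) (Matrix.toLin' (endoOdd p))
    (fun _ => 2 * p + 1) (fun _ => oddChain p (2 * p))
    (fun _ => by
      rw [pow_succ', Module.End.mul_apply, hpow _ le_rfl, Nat.sub_self, endoOdd_oddChain_zero])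
    (by
      refine top_le_span_of_single _ ?_
      rintro (a | b)
      · refine ⟨1, one_ne_zero, ⟨⟨(), ⟨2 * p - a, by omega⟩⟩, ?_⟩⟩
        simp only
        rw [hpow _ (by omega)]
        ext (i | i) <;> simp [oddChain, Pi.single_apply, Fin.ext_iff] <;> grind
      · refine ⟨(-1) ^ (p - b : ℕ), by simp, ⟨⟨(), ⟨b, by omega⟩⟩, ?_⟩⟩
        simp only
        rw [hpow _ (by omega)]
        ext (i | i) <;> simp [oddChain, Pi.single_apply, Fin.ext_iff] <;> grind)
    (by simp; omega) k
  simpa using this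

/-- The chains `E_1, …, E_p` and `F_p, -F_(p-1), …` in `ℂ^(2p)`. -/
def evenChain (p : ℕ) (c : Bool) (i : ℕ) : Fin p ⊕ Fin p → ℂ :=
  Sum.elim (fun a => if c = true ∧ (a : ℕ) = i then 1 else 0)
    (fun b => if c = false ∧ (b : ℕ) + 1 + i = p then (-1) ^ i else 0)

theorem endoEven_mulVec_inl (p : ℕ) (f g : Fin p → ℂ) (a : Fin p) :
    Matrix.toLin' (endoEven p) (Sum.elim f g) (Sum.inl a) =
      if h : (a : ℕ) + 1 < p then f ⟨a + 1, h⟩ else 0 := by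
  simp [endoEven, Matrix.mulVec, dotProduct, jordanBlock, sum_ite_val']

theorem endoEven_mulVec_inr (p : ℕ) (f g : Fin p → ℂ) (b : Fin p) :
    Matrix.toLin' (endoEven p) (Sum.elim f g) (Sum.inr b) =
      -if h : 0 < (b : ℕ) then g ⟨b - 1, by omega⟩ else 0 := by
  simp [endoEven, Matrix.mulVec, dotProduct, jordanBlock, sum_ite_val_succ]
  grind

theorem endoEven_evenChain_succ (p : ℕ) (c : Bool) (i : ℕ) (hi : i < p - 1) :
    Matrix.toLin' (endoEven p) (evenChain p c (i + 1)) = evenChain p c i := by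
  ext (a | b)
  · rw [evenChain, endoEven_mulVec_inl]
    simp only [evenChain, Sum.elim_inl]
    split_ifs <;> grind
  · rw [evenChain, endoEven_mulVec_inr]
    simp only [evenChain, Sum.elim_inr, pow_succ]
    split_ifs <;> grind

theorem endoEven_evenChain_zero (p : ℕ) (c : Bool) :
    Matrix.toLin' (endoEven p) (evenChain p c 0) = 0 := by
  ext (a | b)
  · rw [evenChain, endoEven_mulVec_inl]
    simp only [Pi.zero_apply]
    split_ifs <;> grind
  · rw [evenChain, endoEven_mulVec_inr]
    simp only [Pi.zero_apply]
    split_ifs <;> grind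

theorem finrank_range_endoEven (p k : ℕ) :
    Module.finrank ℂ (LinearMap.range (Matrix.toLin' (endoEven p) ^ k)) = 2 * (p - k) := by
  rcases Nat.eq_zero_or_pos p with rfl | hp
  · have := (LinearMap.range (Matrix.toLin' (endoEven 0) ^ k)).finrank_le
    simpa using this
  have hpow := fun c => LinearMap.pow_apply_of_shift (Matrix.toLin' (endoEven p)) (evenChain p c)
    (p - 1) (endoEven_evenChain_succ p c)
  have := LinearMap.finrank_range_pow_of_chains (Matrix.toLin' (endoEven p))
    (fun _ : Bool => p) (fun c => evenChain p c (p - 1))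
    (fun c => by
      have h1 := hpow c _ le_rfl
      rw [Nat.sub_self] at h1
      have h2 := congrArg (Matrix.toLin' (endoEven p)) h1
      rwa [endoEven_evenChain_zero, ← Module.End.mul_apply, ← pow_succ',
        show p - 1 + 1 = p by omega] at h2)
    (by
      refine top_le_span_of_single _ ?_
      rintro (a | b)
      · refine ⟨1, one_ne_zero, ⟨⟨true, ⟨p - 1 - a, by omega⟩⟩, ?_⟩⟩
        simp only
        rw [hpow _ _ (by omega)]
        ext (i | i) <;> simp [evenChain, Pi.single_apply, Fin.ext_iff]; grind
      · refine ⟨(-1) ^ (p - 1 - b : ℕ), by simp, ⟨⟨false, ⟨b, by omega⟩⟩, ?_⟩⟩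
        simp only
        rw [hpow _ _ (by omega)]
        ext (i | i) <;> simp [evenChain, Pi.single_apply, Fin.ext_iff]; grind)
    (by simp; omega) k
  simpa using this

theorem directSum_endo_pow_apply {ι : Type} [Fintype ι] (D : ι → SkewQuadraticSpace) (k : ℕ)
    (x : (directSum D).carrier) (i : ι) :
    ((directSum D).endo ^ k) x i = ((D i).endo ^ k) (x i) := by
  induction k generalizing x with
  | zero => rfl
  | succ k ih =>
    rw [pow_succ, pow_succ, Module.End.mul_apply, Module.End.mul_apply, ih]
    rfl

theorem finrank_range_directSum_endo_pow {ι : Type} [Fintype ι] (D : ι → SkewQuadraticSpace)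
    (k : ℕ) :
    Module.finrank ℂ (LinearMap.range ((directSum D).endo ^ k)) =
      ∑ i, Module.finrank ℂ (LinearMap.range ((D i).endo ^ k)) := by
  let f : (∀ i, LinearMap.range ((D i).endo ^ k)) →ₗ[ℂ] ∀ i, (D i).carrier :=
    LinearMap.pi fun i => (Submodule.subtype _) ∘ₗ LinearMap.proj i
  have hf : Function.Injective f := fun a b h => by
    funext i
    exact Subtype.ext (congrFun h i)
  have hr : LinearMap.range ((directSum D).endo ^ k) = LinearMap.range f := by
    apply le_antisymm
    · rintro _ ⟨x, rfl⟩
      refine ⟨fun i => ⟨((D i).endo ^ k) (x i), LinearMap.mem_range_self _ _⟩, ?_⟩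
      funext i
      exact (directSum_endo_pow_apply D k x i).symm
    · rintro _ ⟨y, rfl⟩
      choose x hx using fun i => LinearMap.mem_range.mp (y i).2
      refine ⟨x, ?_⟩
      funext i
      exact (directSum_endo_pow_apply D k x i).trans (hx i)
  rw [hr]
  exact (LinearMap.finrank_range_of_inj hf).trans (Module.finrank_pi_fintype ℂ)

theorem finrank_directSum {ι : Type} [Fintype ι] (D : ι → SkewQuadraticSpace) :
    Module.finrank ℂ (directSum D).carrier = ∑ i, Module.finrank ℂ (D i).carrier :=
  Module.finrank_pi_fintype ℂ

theorem finrank_jordanEven (p : ℕ) : Module.finrank ℂ (jordanEven p).carrier = 2 * p := by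
  change Module.finrank ℂ (Fin p ⊕ Fin p → ℂ) = 2 * p
  simp; omega

theorem finrank_jordanOdd (p : ℕ) : Module.finrank ℂ (jordanOdd p).carrier = 2 * p + 1 := by
  change Module.finrank ℂ (Fin (p + 1) ⊕ Fin p → ℂ) = 2 * p + 1
  simp; omega

end SkewQuadraticSpace

/-! ### The Jordan type of C_[d] is d -/

namespace SpecialPartition

open SkewQuadraticSpace

variable {n : ℕ}

/-- The skew-symmetric map `C_[d]`. -/
def skewSpace (d : SpecialPartition n) : SkewQuadraticSpace := directSum d.blocks.get

/-- An even block of parameter p consists of two Jordan blocks of size p, and an odd one of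
parameter q is a single Jordan block of size 2q + 1. -/
theorem finrank_range_skewSpace_endo_pow (d : SpecialPartition n) (k : ℕ) :
    Module.finrank ℂ (LinearMap.range (d.skewSpace.endo ^ k)) = (d.1.parts.map (· - k)).sum := by
  have h1 : ∀ p, Module.finrank ℂ (LinearMap.range ((jordanEven p).endo ^ k)) = 2 * (p - k) :=
    fun p => finrank_range_endoEven p k
  have h2 : ∀ p, Module.finrank ℂ (LinearMap.range ((jordanOdd p).endo ^ k)) = 2 * p + 1 - k :=
    fun p => finrank_range_endoOdd p k
  rw [skewSpace, finrank_range_directSum_endo_pow]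
  have h4 : ∑ i, Module.finrank ℂ (LinearMap.range ((d.blocks.get i).endo ^ k)) =
      (d.blocks.map fun D => Module.finrank ℂ (LinearMap.range (D.endo ^ k))).sum := by
    rw [← List.sum_ofFn]
    congr 1
    exact List.ofFn_getElem_eq_map d.blocks (fun D => Module.finrank ℂ (LinearMap.range (D.endo ^ k)))
  rw [h4, parts_eq, blocks]
  simp only [List.map_append, List.map_map, List.sum_append, Multiset.map_add, Multiset.sum_add,
    Multiset.map_coe, Multiset.sum_coe, Function.comp_def, h1, h2]
  rw [← two_mul, ← List.sum_map_mul_left]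

theorem finrank_skewSpace (d : SpecialPartition n) :
    Module.finrank ℂ d.skewSpace.carrier = n := by
  have h := d.finrank_range_skewSpace_endo_pow 0
  rw [pow_zero, Module.End.one_eq_id, LinearMap.range_id, finrank_top] at h
  simpa [d.1.parts_sum] using h

/-- The case k = 0 is automatic, both ranks being n; only positive powers can be read off from the
Lie bracket. -/
theorem eq_of_finrank_range_eq {d d' : SpecialPartition n}
    (h : ∀ k, 1 ≤ k → Module.finrank ℂ (LinearMap.range (d.skewSpace.endo ^ k)) =
      Module.finrank ℂ (LinearMap.range (d'.skewSpace.endo ^ k))) : d = d' := by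
  refine Subtype.ext (Nat.Partition.ext (Multiset.eq_of_sum_map_sub_eq d.zero_notMem_parts
    d'.zero_notMem_parts fun k => ?_))
  rcases Nat.eq_zero_or_pos k with rfl | hk
  · simp [d.1.parts_sum, d'.1.parts_sum]
  · rw [← finrank_range_skewSpace_endo_pow, ← finrank_range_skewSpace_endo_pow, h k hk]

theorem skewSpace_endo_pow_eq_zero (d : SpecialPartition n) : d.skewSpace.endo ^ n = 0 := by
  rw [← LinearMap.range_eq_bot, ← Submodule.finrank_eq_zero (R := ℂ),
    finrank_range_skewSpace_endo_pow]
  refine Multiset.sum_eq_zero fun m hm => ?_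
  obtain ⟨a, ha, rfl⟩ := Multiset.mem_map.mp hm
  have := Multiset.le_sum_of_mem ha
  rw [d.1.parts_sum] at this
  omega

theorem skewSpace_endo_ne_zero (d : SpecialPartition n) : d.skewSpace.endo ≠ 0 := by
  intro h
  have h1 := d.finrank_range_skewSpace_endo_pow 1
  rw [pow_one, h, LinearMap.range_zero, finrank_bot] at h1
  obtain ⟨m, hm, hm1⟩ := d.2.2
  have := Multiset.sum_eq_zero_iff.mp h1.symm _ (Multiset.mem_map_of_mem (· - 1) hm)
  have := d.1.parts_pos hm
  omega

end SpecialPartition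

/-! ### Double extensions of skew-symmetric maps -/

namespace QuadraticLieAlgebra

theorem wedgeThreeForm_apply {V : Type u} [AddCommGroup V] [Module ℂ V] (I : V [⋀^Fin 3]→ₗ[ℂ] ℂ)
    (α : Module.Dual ℂ V) (v : Fin 4 → V) :
    wedgeThreeForm I α v = α (v 0) * I ![v 1, v 2, v 3] - α (v 1) * I ![v 0, v 2, v 3] +
      α (v 2) * I ![v 0, v 1, v 3] - α (v 3) * I ![v 0, v 1, v 2] := by
  have key : ∑ i : Fin 4, (-1 : ℤ) ^ (i : ℕ) • (α (v i) * I (i.removeNth v)) =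
      α (v 0) * I ![v 1, v 2, v 3] - α (v 1) * I ![v 0, v 2, v 3] +
        α (v 2) * I ![v 0, v 1, v 3] - α (v 3) * I ![v 0, v 1, v 2] := by
    have h0 : (0 : Fin 4).removeNth v = ![v 1, v 2, v 3] := by ext i; fin_cases i <;> rfl
    have h1 : (1 : Fin 4).removeNth v = ![v 0, v 2, v 3] := by ext i; fin_cases i <;> rfl
    have h2 : (2 : Fin 4).removeNth v = ![v 0, v 1, v 3] := by ext i; fin_cases i <;> rfl
    have h3 : (3 : Fin 4).removeNth v = ![v 0, v 1, v 2] := by ext i; fin_cases i <;> rfl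
    rw [Fin.sum_univ_four, h0, h1, h2, h3]
    norm_num
    ring
  exact (AlternatingMap.alternatizeUncurryFin_apply _ _).trans key

end QuadraticLieAlgebra

namespace SkewQuadraticSpace

variable (D : SkewQuadraticSpace)

theorem finrank_ext : Module.finrank ℂ D.Ext = Module.finrank ℂ D.carrier + 2 := by
  rw [((Ext.equivProd D).linearEquiv ℂ).finrank_eq, Module.finrank_prod, Module.finrank_prod,
    Module.finrank_self]

theorem not_isLieAbelian_ext (h : D.endo ≠ 0) : ¬ IsLieAbelian D.Ext := by
  intro hab
  refine h (LinearMap.ext fun v => ?_)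
  have := congrArg Ext.q (hab.trivial (⟨0, 0, 1⟩ : D.Ext) ⟨v, 0, 0⟩)
  simpa using this

/-- The linear form `B(X₁, ·)` on the double extension. -/
def coordY : Module.Dual ℂ D.Ext where
  toFun u := u.y
  map_add' _ _ := rfl
  map_smul' _ _ := rfl

/-- Here I = α ∧ Ω, with α the Y₁-coordinate and Ω(u, v) = B(C u, v), and α ∧ α = 0. -/
theorem wedge_coordY :
    QuadraticLieAlgebra.wedgeThreeForm D.doubleExtension.threeForm D.coordY = 0 := by
  refine AlternatingMap.ext fun (v : Fin 4 → D.Ext) => ?_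
  have h12 := D.skew (v 1).q (v 2).q
  have h13 := D.skew (v 1).q (v 3).q
  have h23 := D.skew (v 2).q (v 3).q
  have h01 := D.skew (v 0).q (v 1).q
  have h02 := D.skew (v 0).q (v 2).q
  have h03 := D.skew (v 0).q (v 3).q
  have c12 := D.form_comm (v 1).q (D.endo (v 2).q)
  have c13 := D.form_comm (v 1).q (D.endo (v 3).q)
  have c23 := D.form_comm (v 2).q (D.endo (v 3).q)
  have c01 := D.form_comm (v 0).q (D.endo (v 1).q)
  have c02 := D.form_comm (v 0).q (D.endo (v 2).q)
  have c03 := D.form_comm (v 0).q (D.endo (v 3).q)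
  have key : (v 0).y * D.extForm ⁅v 1, v 2⁆ (v 3) - (v 1).y * D.extForm ⁅v 0, v 2⁆ (v 3) +
      (v 2).y * D.extForm ⁅v 0, v 1⁆ (v 3) - (v 3).y * D.extForm ⁅v 0, v 1⁆ (v 2) = 0 := by
    simp only [extForm_apply, Ext.lie_q, Ext.lie_x, Ext.lie_y, map_sub, map_smul,
      LinearMap.sub_apply, LinearMap.smul_apply, smul_eq_mul]
    simp only [h12, h13, h23, h01, h02, h03, c12, c13, c23, c01, c02, c03]
    ring
  exact (QuadraticLieAlgebra.wedgeThreeForm_apply _ _ _).trans key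

theorem one_le_dup : 1 ≤ D.doubleExtension.dup := by
  have hne : D.coordY ≠ 0 := fun h => by
    have := LinearMap.congr_fun h (⟨0, 0, 1⟩ : D.Ext)
    exact one_ne_zero this
  have : Nontrivial (LinearMap.ker
      (QuadraticLieAlgebra.wedgeThreeForm D.doubleExtension.threeForm)) :=
    ⟨⟨⟨D.coordY, D.wedge_coordY⟩, 0, fun h => hne (congrArg Subtype.val h)⟩⟩
  exact Module.finrank_pos (R := ℂ) (M := LinearMap.ker
    (QuadraticLieAlgebra.wedgeThreeForm D.doubleExtension.threeForm))

/-! ### Ranks of powers of ad in a double extension -/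

variable {D}

/-- The map `w ↦ w - c B(q, w) X₁` into the double extension. -/
def graphMap (q : D.carrier) (c : ℂ) : D.carrier →ₗ[ℂ] D.Ext where
  toFun w := ⟨w, -(c * D.form q w), 0⟩
  map_add' a b := by ext <;> simp; ring
  map_smul' a b := by ext <;> simp; ring

/-- With u = q + xX₁ + yY₁, the bracket with w has X₁-component B(Cq, w) = -B(q, Cw), which is the
graph of slope 1/y evaluated at yCw. So ad u preserves this graph and acts on it as yC. -/
theorem ad_graphMap (u : D.Ext) (hu : u.y ≠ 0) (w : D.carrier) :
    LieAlgebra.ad ℂ D.Ext u (graphMap u.q u.y⁻¹ w) = graphMap u.q u.y⁻¹ (u.y • D.endo w) := by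
  have := D.skew u.q w
  ext <;> simp [graphMap, this, hu]

theorem ad_apply_eq_graphMap (u : D.Ext) (hu : u.y ≠ 0) (v : D.Ext) :
    LieAlgebra.ad ℂ D.Ext u v = graphMap u.q u.y⁻¹ (D.endo (u.y • v.q - v.y • u.q)) := by
  have h := D.skew u.q v.q
  have h' := D.form_endo_self u.q
  rw [D.form_comm] at h'
  ext <;> simp [graphMap, h, h', hu]

/-- One application of ad u already lands in the stable graph, and the others act there as multiples
of C. Hence the rank of (ad u)^(k+1) is at most that of C^(k+1). -/
theorem ad_pow_succ_apply (u : D.Ext) (hu : u.y ≠ 0) (v : D.Ext) (k : ℕ) :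
    (LieAlgebra.ad ℂ D.Ext u ^ (k + 1)) v =
      graphMap u.q u.y⁻¹ (u.y ^ k • (D.endo ^ (k + 1)) (u.y • v.q - v.y • u.q)) := by
  induction k with
  | zero => simpa using ad_apply_eq_graphMap u hu v
  | succ k ih =>
    rw [pow_succ', Module.End.mul_apply, ih, ad_graphMap u hu, D.endo.map_smul, smul_smul, ← pow_succ',
      ← Module.End.mul_apply, ← pow_succ']

theorem ad_sq_apply_of_y_eq_zero (u : D.Ext) (hu : u.y = 0) (v : D.Ext) :
    (LieAlgebra.ad ℂ D.Ext u ^ 2) v = ⟨0, v.y * D.form (D.endo (D.endo u.q)) u.q, 0⟩ := by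
  have h' := D.skew (D.endo u.q) u.q
  rw [pow_two, Module.End.mul_apply]
  ext <;> simp [hu, h']

theorem ad_cube_of_y_eq_zero (u : D.Ext) (hu : u.y = 0) : LieAlgebra.ad ℂ D.Ext u ^ 3 = 0 := by
  refine LinearMap.ext fun v => ?_
  rw [pow_succ, Module.End.mul_apply, ad_sq_apply_of_y_eq_zero u hu]
  ext <;> simp

/-- By Engel's theorem it is enough that each ad u is nilpotent: nilpotency of C gives this off the
hyperplane y = 0, and on it the cube vanishes. -/
theorem isNilpotent_ext (h : IsNilpotent D.endo) : LieRing.IsNilpotent D.Ext := by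
  rw [LieAlgebra.isNilpotent_iff_forall (R := ℂ)]
  intro u
  by_cases hu : u.y = 0
  · exact ⟨3, ad_cube_of_y_eq_zero u hu⟩
  · obtain ⟨k, hk⟩ := h
    refine ⟨k + 1, LinearMap.ext fun v => ?_⟩
    rw [ad_pow_succ_apply u hu, pow_succ, hk]
    simp

/-- The form B(C x, y) is alternating: if it is nonzero on (v, w), pairing with v and w shows that C
v and C w are independent. -/
theorem two_le_finrank_range_endo (h : D.endo ≠ 0) :
    2 ≤ Module.finrank ℂ (LinearMap.range D.endo) := by
  obtain ⟨v, hv⟩ : ∃ v, D.endo v ≠ 0 := by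
    by_contra! h'
    exact h (LinearMap.ext h')
  obtain ⟨w, hw⟩ : ∃ w, D.form (D.endo v) w ≠ 0 := by
    by_contra! h'
    exact hv (D.nondeg.1 _ h')
  have hw' : D.form (D.endo w) v ≠ 0 := by
    rwa [D.skew, neg_ne_zero, D.form_comm]
  have li : LinearIndependent ℂ ![(⟨D.endo v, v, rfl⟩ : LinearMap.range D.endo),
      ⟨D.endo w, w, rfl⟩] := by
    rw [LinearIndependent.pair_iff]
    intro s t hst
    have hst' : s • D.endo v + t • D.endo w = 0 := congrArg Subtype.val hst
    have h1 := congrArg (fun z => D.form z v) hst'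
    have h2 := congrArg (fun z => D.form z w) hst'
    simp only [map_add, map_smul, LinearMap.add_apply, LinearMap.smul_apply, form_endo_self,
      smul_eq_mul, map_zero, LinearMap.zero_apply, mul_zero, zero_add, add_zero,
      mul_eq_zero] at h1 h2
    exact ⟨h2.resolve_right hw, h1.resolve_right hw'⟩
  simpa using li.fintype_card_le_finrank

/-- Off the hyperplane y = 0 the range lies in a graph over the range of C^k. On it, ad u, its
square and its cube have ranks at most 2, 1 and 0, which the ranks of the powers of C dominate. -/
theorem finrank_range_ad_pow_le (h : D.endo ≠ 0) (u : D.Ext) (k : ℕ) (hk : 1 ≤ k) :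
    Module.finrank ℂ (LinearMap.range (LieAlgebra.ad ℂ D.Ext u ^ k)) ≤
      Module.finrank ℂ (LinearMap.range (D.endo ^ k)) := by
  obtain ⟨k, rfl⟩ := Nat.exists_eq_add_of_le' hk
  by_cases hu : u.y = 0
  · rcases k with _ | _ | k
    · rw [zero_add, pow_one, pow_one]
      refine le_trans ?_ (two_le_finrank_range_endo h)
      classical
      have hle : LinearMap.range (LieAlgebra.ad ℂ D.Ext u) ≤
          Submodule.span ℂ (({⟨-D.endo u.q, 0, 0⟩, ⟨0, 1, 0⟩} : Finset D.Ext) : Set D.Ext) := by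
        rintro _ ⟨v, rfl⟩
        simp only [Finset.coe_insert, Finset.coe_singleton, Submodule.mem_span_pair]
        refine ⟨v.y, D.form (D.endo u.q) v.q, ?_⟩
        ext <;> simp [hu]
      exact (Submodule.finrank_mono hle).trans
        ((finrank_span_finset_le_card _).trans Finset.card_le_two)
    -- The square of ad u has rank at most 1, and it vanishes if C² does.
    · by_cases h2 : D.endo ^ 2 = 0
      · have : LieAlgebra.ad ℂ D.Ext u ^ 2 = 0 := by
          refine LinearMap.ext fun v => ?_
          have h3 : D.endo (D.endo u.q) = 0 := by
            have := LinearMap.congr_fun h2 u.q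
            rwa [pow_two] at this
          rw [ad_sq_apply_of_y_eq_zero u hu, h3]
          ext <;> simp
        rw [zero_add, this, LinearMap.range_zero, finrank_bot]
        exact Nat.zero_le _
      · have hpos : 1 ≤ Module.finrank ℂ (LinearMap.range (D.endo ^ 2)) := by
          rw [Nat.one_le_iff_ne_zero, Ne, Submodule.finrank_eq_zero, LinearMap.range_eq_bot]
          exact h2
        refine le_trans ?_ hpos
        have hle : LinearMap.range (LieAlgebra.ad ℂ D.Ext u ^ 2) ≤
            Submodule.span ℂ (({⟨0, 1, 0⟩} : Finset D.Ext) : Set D.Ext) := by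
          rintro _ ⟨v, rfl⟩
          rw [ad_sq_apply_of_y_eq_zero u hu, Finset.coe_singleton, Submodule.mem_span_singleton]
          refine ⟨v.y * D.form (D.endo (D.endo u.q)) u.q, ?_⟩
          ext <;> simp
        exact (Submodule.finrank_mono hle).trans (finrank_span_finset_le_card _)
    · rw [show k + 1 + 1 + 1 = k + 3 by ring, pow_add, ad_cube_of_y_eq_zero u hu, mul_zero,
        LinearMap.range_zero, finrank_bot]
      exact Nat.zero_le _
  · have hle : LinearMap.range (LieAlgebra.ad ℂ D.Ext u ^ (k + 1)) ≤
        (LinearMap.range (D.endo ^ (k + 1))).map (graphMap u.q u.y⁻¹) := by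
      rintro _ ⟨v, rfl⟩
      rw [ad_pow_succ_apply u hu]
      exact Submodule.mem_map_of_mem (Submodule.smul_mem _ _ (LinearMap.mem_range_self _ _))
    exact (Submodule.finrank_mono hle).trans (Submodule.finrank_map_le _ _)

/-- At u = Y₁ the graph is 𝔮 itself, on which ad Y₁ is C. -/
theorem finrank_range_endo_pow_le_ad_pow (k : ℕ) :
    Module.finrank ℂ (LinearMap.range (D.endo ^ (k + 1))) ≤
      Module.finrank ℂ (LinearMap.range (LieAlgebra.ad ℂ D.Ext ⟨0, 0, 1⟩ ^ (k + 1))) := by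
  have hinj : Function.Injective (graphMap (0 : D.carrier) 1) := fun a b h => congrArg Ext.q h
  rw [(Submodule.equivMapOfInjective _ hinj _).finrank_eq]
  refine Submodule.finrank_mono ?_
  rintro _ ⟨_, ⟨w, rfl⟩, rfl⟩
  refine ⟨⟨w, 0, 0⟩, ?_⟩
  rw [ad_pow_succ_apply _ one_ne_zero]
  simp

/-- The rank of (ad Y₁)^k is carried to the image of Y₁, where the upper bound applies; no
compatibility with the forms is involved. -/
theorem finrank_range_endo_pow_le_of_lieEquiv {D' : SkewQuadraticSpace} (h : D'.endo ≠ 0)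
    (e : D.Ext ≃ₗ⁅ℂ⁆ D'.Ext) (k : ℕ) (hk : 1 ≤ k) :
    Module.finrank ℂ (LinearMap.range (D.endo ^ k)) ≤
      Module.finrank ℂ (LinearMap.range (D'.endo ^ k)) := by
  refine le_trans ?_ (finrank_range_ad_pow_le h (e ⟨0, 0, 1⟩) k hk)
  obtain ⟨k, rfl⟩ := Nat.exists_eq_add_of_le' hk
  refine (finrank_range_endo_pow_le_ad_pow k).trans ?_
  have hcomm : ∀ m (v : D.Ext), e ((LieAlgebra.ad ℂ D.Ext ⟨0, 0, 1⟩ ^ m) v) =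
      (LieAlgebra.ad ℂ D'.Ext (e ⟨0, 0, 1⟩) ^ m) (e v) := by
    intro m
    induction m with
    | zero => intro v; rfl
    | succ m ih =>
      intro v
      rw [pow_succ', Module.End.mul_apply, LieAlgebra.ad_apply, LieEquiv.map_lie, ih, pow_succ',
        Module.End.mul_apply, LieAlgebra.ad_apply]
  let f : D.Ext →ₗ[ℂ] D'.Ext := (e : D.Ext →ₗ⁅ℂ⁆ D'.Ext)
  have hinj : Function.Injective f := e.injective
  rw [(Submodule.equivMapOfInjective _ hinj _).finrank_eq]
  refine Submodule.finrank_mono ?_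
  rintro _ ⟨_, ⟨w, rfl⟩, rfl⟩
  exact ⟨e w, (hcomm _ _).symm⟩

end SkewQuadraticSpace

/-! ### The algebras 𝔤_[d] are nilpotent singular and pairwise non-isomorphic -/

namespace SpecialPartition

variable {n : ℕ}

theorem lieAlgebra_isNilpotentSingular (d : SpecialPartition n) :
    d.lieAlgebra.IsNilpotentSingular (n + 2) := by
  refine ⟨?_, ?_, ?_, ?_⟩
  · have := d.skewSpace.finrank_ext
    rwa [finrank_skewSpace] at this
  · exact SkewQuadraticSpace.isNilpotent_ext (D := d.skewSpace) ⟨n, d.skewSpace_endo_pow_eq_zero⟩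
  · exact d.skewSpace.not_isLieAbelian_ext d.skewSpace_endo_ne_zero
  · exact d.skewSpace.one_le_dup

theorem eq_of_isom {d d' : SpecialPartition n} (h : d.lieAlgebra.Isom d'.lieAlgebra) :
    d = d' := by
  obtain ⟨e⟩ := h
  have e' : d.skewSpace.Ext ≃ₗ⁅ℂ⁆ d'.skewSpace.Ext := e
  refine eq_of_finrank_range_eq fun k hk => le_antisymm ?_ ?_
  · exact SkewQuadraticSpace.finrank_range_endo_pow_le_of_lieEquiv d'.skewSpace_endo_ne_zero e' k hk
  · exact SkewQuadraticSpace.finrank_range_endo_pow_le_of_lieEquiv d.skewSpace_endo_ne_zero e'.symm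
      k hk

end SpecialPartition

/-! ### Nilpotent skew-symmetric maps -/

/-- `C` is skew-symmetric for the symmetric bilinear form `B`. -/
structure LinearMap.IsSkewFor {V : Type*} [AddCommGroup V] [Module ℂ V]
    (B : LinearMap.BilinForm ℂ V) (C : V →ₗ[ℂ] V) : Prop where
  comm : ∀ x y, B x y = B y x
  skew : ∀ x y, B (C x) y = -B x (C y)

namespace LinearMap.IsSkewFor

variable {V : Type*} [AddCommGroup V] [Module ℂ V] {B : LinearMap.BilinForm ℂ V} {C : V →ₗ[ℂ] V}

theorem pow_left (h : IsSkewFor B C) (i : ℕ) (x y : V) :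
    B ((C ^ i) x) y = (-1) ^ i * B x ((C ^ i) y) := by
  induction i generalizing x y with
  | zero => simp
  | succ i ih =>
    rw [pow_succ' C, Module.End.mul_apply, h.skew, ih, ← Module.End.mul_apply, ← pow_succ, ← pow_succ']
    ring

theorem pow_left_pow_right (h : IsSkewFor B C) (i j : ℕ) (x y : V) :
    B ((C ^ i) x) ((C ^ j) y) = (-1) ^ i * B x ((C ^ (j + i)) y) := by
  rw [h.pow_left, ← Module.End.mul_apply, ← pow_add, add_comm]

theorem pow_comm (h : IsSkewFor B C) (i : ℕ) (x y : V) :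
    B x ((C ^ i) y) = (-1) ^ i * B y ((C ^ i) x) := by
  rw [h.comm, h.pow_left]

theorem self_pow_odd (h : IsSkewFor B C) {i : ℕ} (hi : Odd i) (x : V) :
    B x ((C ^ i) x) = 0 := by
  have := h.pow_comm i x x
  rw [hi.neg_one_pow, neg_one_mul] at this
  exact self_eq_neg.mp this

theorem pow_eq_zero_of_lt {m : ℕ} (hm : C ^ (m + 1) = 0) {j : ℕ} (hj : m < j) (x : V) :
    (C ^ j) x = 0 := by
  rw [show j = (j - (m + 1)) + (m + 1) by omega, pow_add, hm, mul_zero, LinearMap.zero_apply]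

/-- The quadratic term of the perturbation contains C^(j + 2s), which vanishes in this range, so
pairings change linearly. -/
theorem first_order (h : IsSkewFor B C) {m : ℕ} (hm : C ^ (m + 1) = 0) {j s : ℕ}
    (hj : m < j + 2 * s) (x u y v : V) :
    B (x + (C ^ s) u) ((C ^ j) (y + (C ^ s) v)) =
      B x ((C ^ j) y) + B x ((C ^ (j + s)) v) + (-1) ^ s * B u ((C ^ (j + s)) y) := by
  have e1 : (C ^ j) ((C ^ s) v) = (C ^ (j + s)) v := by rw [pow_add, Module.End.mul_apply]
  have e2 : B ((C ^ s) u) ((C ^ (j + s)) v) = 0 := by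
    rw [h.pow_left_pow_right, pow_eq_zero_of_lt hm (by omega), map_zero, mul_zero]
  rw [map_add (C ^ j), e1, map_add B, map_add, LinearMap.add_apply, LinearMap.add_apply, e2,
    h.pow_left_pow_right]
  ring

/-- A vector generating a non-degenerate cyclic subspace can be normalised. -/
theorem exists_normalized (h : IsSkewFor B C) {m : ℕ} (hm : C ^ (m + 1) = 0) (heven : Even m)
    {x₀ : V} (hx₀ : B x₀ ((C ^ m) x₀) ≠ 0) {c : ℂ} (hc : c ≠ 0) :
    ∃ x, B x ((C ^ m) x) = c ∧ ∀ j, j ≠ m → B x ((C ^ j) x) = 0 := by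
  -- Downward sweep: at stage k the pairings with C^j vanish for m - k ≤ j < m.
  have key : ∀ k ≤ m, ∃ x, B x ((C ^ m) x) = c ∧ ∀ j < m, m ≤ j + k → B x ((C ^ j) x) = 0 := by
    intro k
    induction k with
    | zero =>
      intro _
      obtain ⟨t, ht⟩ := IsAlgClosed.exists_pow_nat_eq (c / B x₀ ((C ^ m) x₀)) two_pos
      refine ⟨t • x₀, ?_, fun j hj hj' => by omega⟩
      simp only [map_smul, LinearMap.smul_apply, smul_eq_mul]
      rw [← mul_assoc, ← pow_two, ht, div_mul_cancel₀ _ hx₀]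
    | succ k ih =>
      intro hk
      obtain ⟨x, hx, hx'⟩ := ih (by omega)
      rcases Nat.even_or_odd (k + 1) with he | ho
      · set s := k + 1 with hs
        -- Adding t C^s x changes the pairing at exponent m - s by 2tc and leaves those at higher
        -- exponents unchanged. For odd s no correction is needed: m - s is odd and skewness kills
        -- the pairing.
        set t : ℂ := -(B x ((C ^ (m - s)) x)) / (2 * c) with ht
        have hfo : ∀ j, m ≤ j + s → B (x + (C ^ s) (t • x)) ((C ^ j) (x + (C ^ s) (t • x))) =
            B x ((C ^ j) x) + 2 * t * B x ((C ^ (j + s)) x) := by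
          intro j hj
          rw [h.first_order hm (by omega), he.neg_one_pow]
          simp only [map_smul, LinearMap.smul_apply, smul_eq_mul]
          ring
        refine ⟨x + (C ^ s) (t • x), ?_, fun j hj hj' => ?_⟩
        · rw [hfo m (by omega), pow_eq_zero_of_lt hm (show m < m + s by omega), hx, map_zero, mul_zero, add_zero]
        · rw [hfo j hj']
          by_cases hjs : j + s = m
          · rw [hjs, hx, show j = m - s by omega, ht]
            field_simp
            ring
          · rw [hx' j hj (by omega), pow_eq_zero_of_lt hm (show m < j + s by omega), map_zero, mul_zero, add_zero]
      · refine ⟨x, hx, fun j hj hj' => ?_⟩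
        by_cases hjs : j + (k + 1) = m
        · refine h.self_pow_odd ?_ x
          rw [← hjs, Nat.even_add] at heven
          rw [← Nat.not_even_iff_odd] at ho ⊢
          exact fun hj => ho (heven.mp hj)
        · exact hx' j hj (by omega)
  obtain ⟨x, hx, hx'⟩ := key m le_rfl
  refine ⟨x, hx, fun j hj => ?_⟩
  rcases lt_or_gt_of_ne hj with hj | hj
  · exact hx' j hj (by omega)
  · rw [pow_eq_zero_of_lt hm hj, map_zero]

/-- A pair of vectors generating a non-degenerate subspace can be normalised to a pair generating
two totally isotropic cyclic subspaces in duality. -/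
theorem exists_normalized_pair (h : IsSkewFor B C) {m : ℕ} (hm : C ^ (m + 1) = 0) (hodd : Odd m)
    {x₀ y₀ : V} (hx₀ : B x₀ ((C ^ m) y₀) ≠ 0) :
    ∃ x y, B x ((C ^ m) y) = 1 ∧ (∀ j, j ≠ m → B x ((C ^ j) y) = 0) ∧
      (∀ j, B x ((C ^ j) x) = 0) ∧ ∀ j, B y ((C ^ j) y) = 0 := by
  have key : ∀ k ≤ m, ∃ x y, B x ((C ^ m) y) = 1 ∧ ∀ j < m, m ≤ j + k →
      B x ((C ^ j) y) = 0 ∧ B x ((C ^ j) x) = 0 ∧ B y ((C ^ j) y) = 0 := by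
    intro k
    induction k with
    | zero =>
      intro _
      refine ⟨(B x₀ ((C ^ m) y₀))⁻¹ • x₀, y₀, ?_, fun j hj hj' => by omega⟩
      rw [map_smul, LinearMap.smul_apply, smul_eq_mul, inv_mul_cancel₀ hx₀]
    | succ k ih =>
      intro hk
      obtain ⟨x, y, hxy, hx'⟩ := ih (by omega)
      set s := k + 1 with hs
      -- At exponent m - s, α cancels the mixed pairing, while β and γ cancel the self-pairings of x
      -- and y when s is odd. For even s, m - s is odd, so these self-pairings vanish and β = γ = 0.
      -- The corrections do not interfere, since x and y pair to zero with their own images under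
      -- C^j for j ≥ m.
      set α : ℂ := -((-1) ^ s * B x ((C ^ (m - s)) y)) with hα
      set β : ℂ := -(B x ((C ^ (m - s)) x)) / 2 with hβ
      set γ : ℂ := B y ((C ^ (m - s)) y) / 2 with hγ
      have hxx : ∀ j, m ≤ j → B x ((C ^ j) x) = 0 := by
        intro j hj
        rcases hj.lt_or_eq with hj | rfl
        · rw [pow_eq_zero_of_lt hm hj, map_zero]
        · exact h.self_pow_odd hodd x
      have hyy : ∀ j, m ≤ j → B y ((C ^ j) y) = 0 := by
        intro j hj
        rcases hj.lt_or_eq with hj | rfl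
        · rw [pow_eq_zero_of_lt hm hj, map_zero]
        · exact h.self_pow_odd hodd y
      have hyx : B y ((C ^ m) x) = -1 := by
        rw [h.pow_comm, hodd.neg_one_pow, hxy]; norm_num
      have fxy : ∀ j, m ≤ j + s →
          B (x + (C ^ s) (α • x + β • y)) ((C ^ j) (y + (C ^ s) (γ • x))) =
            B x ((C ^ j) y) + (-1) ^ s * α * B x ((C ^ (j + s)) y) := by
        intro j hj
        rw [h.first_order hm (by omega)]
        simp only [map_smul, map_add, LinearMap.add_apply, LinearMap.smul_apply, smul_eq_mul,
          hxx _ hj, hyy _ hj]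
        ring
      have fxx : ∀ j, m ≤ j + s →
          B (x + (C ^ s) (α • x + β • y)) ((C ^ j) (x + (C ^ s) (α • x + β • y))) =
            B x ((C ^ j) x) + β * B x ((C ^ (j + s)) y) +
              (-1) ^ s * β * B y ((C ^ (j + s)) x) := by
        intro j hj
        rw [h.first_order hm (by omega)]
        simp only [map_smul, map_add, LinearMap.add_apply, LinearMap.smul_apply, smul_eq_mul,
          hxx _ hj]
        ring
      have fyy : ∀ j, m ≤ j + s →
          B (y + (C ^ s) (γ • x)) ((C ^ j) (y + (C ^ s) (γ • x))) =
            B y ((C ^ j) y) + γ * B y ((C ^ (j + s)) x) +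
              (-1) ^ s * γ * B x ((C ^ (j + s)) y) := by
        intro j hj
        rw [h.first_order hm (by omega)]
        simp only [map_smul, LinearMap.smul_apply, smul_eq_mul]
        ring
      refine ⟨x + (C ^ s) (α • x + β • y), y + (C ^ s) (γ • x), ?_, fun j hj hj' => ?_⟩
      · rw [fxy m (by omega), hxy, pow_eq_zero_of_lt hm (show m < m + s by omega), map_zero]
        ring
      · rw [fxy j hj', fxx j hj', fyy j hj']
        by_cases hjs : j + s = m
        · obtain rfl : j = m - s := by omega
          rw [hjs, hxy, hyx]
          rcases Nat.even_or_odd s with he | ho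
          · have hjo : Odd (m - s) := by
              rw [← hjs, Nat.odd_add] at hodd
              exact hodd.mpr he
            rw [he.neg_one_pow] at hα ⊢
            rw [hα, hβ, hγ, h.self_pow_odd hjo, h.self_pow_odd hjo]
            refine ⟨?_, ?_, ?_⟩ <;> ring
          · rw [ho.neg_one_pow] at hα ⊢
            rw [hα, hβ, hγ]
            refine ⟨?_, ?_, ?_⟩ <;> ring
        · obtain ⟨h1, h2, h3⟩ := hx' j hj (by omega)
          have h0 : ∀ z, (C ^ (j + s)) z = 0 := fun z => pow_eq_zero_of_lt hm (by omega) z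
          simp [h1, h2, h3, h0]
  obtain ⟨x, y, hxy, hx'⟩ := key m le_rfl
  refine ⟨x, y, hxy, fun j hj => ?_, fun j => ?_, fun j => ?_⟩
  · rcases lt_or_gt_of_ne hj with hj | hj
    · exact (hx' j hj (by omega)).1
    · rw [pow_eq_zero_of_lt hm hj, map_zero]
  · rcases lt_trichotomy j m with hj | rfl | hj
    · exact (hx' j hj (by omega)).2.1
    · exact h.self_pow_odd hodd x
    · rw [pow_eq_zero_of_lt hm hj, map_zero]
  · rcases lt_trichotomy j m with hj | rfl | hj
    · exact (hx' j hj (by omega)).2.2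
    · exact h.self_pow_odd hodd y
    · rw [pow_eq_zero_of_lt hm hj, map_zero]

end LinearMap.IsSkewFor

/-! ### Decomposition of nilpotent skew-symmetric maps -/

theorem Fin.sum_ite_eq_val {M : Type*} [AddCommMonoid M] {n : ℕ} (m : ℕ) (f : Fin n → M) :
    (∑ j : Fin n, if (j : ℕ) = m then f j else 0) = if h : m < n then f ⟨m, h⟩ else 0 := by
  split_ifs with h
  · rw [Finset.sum_eq_single ⟨m, h⟩] <;> simp +contextual [Fin.ext_iff]
  · exact Finset.sum_eq_zero fun j _ => if_neg (by omega)

theorem Fin.sum_ite_val_succ_eq {M : Type*} [AddCommMonoid M] {n : ℕ} (m : ℕ) (f : Fin n → M) :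
    (∑ j : Fin n, if (j : ℕ) + 1 = m then f j else 0) =
      if h : 0 < m ∧ m - 1 < n then f ⟨m - 1, h.2⟩ else 0 := by
  split_ifs with h
  · rw [Finset.sum_eq_single ⟨m - 1, h.2⟩]
    · rw [if_pos (Nat.sub_add_cancel h.1)]
    · exact fun j _ hj => if_neg fun hm => hj (Fin.ext (by simp only; omega))
    · simp
  · exact Finset.sum_eq_zero fun j _ => if_neg (by omega)

theorem LinearMap.BilinForm.nondegenerate_of_symm {V : Type*} [AddCommGroup V] [Module ℂ V]
    {B : LinearMap.BilinForm ℂ V} (hc : ∀ x y, B x y = B y x)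
    (h : ∀ x, (∀ y, B x y = 0) → x = 0) : B.Nondegenerate :=
  ⟨h, fun y hy => h y fun x => (hc y x).trans (hy x)⟩

namespace SkewQuadraticSpace

variable {V : Type*} [AddCommGroup V] [Module ℂ V] {B : LinearMap.BilinForm ℂ V} {C : V →ₗ[ℂ] V}

/-- `φ` embeds the quadratic space `S` into `(V, B)` and intertwines the endomorphisms. -/
structure IsModel (S : SkewQuadraticSpace) (B : LinearMap.BilinForm ℂ V) (C : V →ₗ[ℂ] V)
    (φ : S.carrier →ₗ[ℂ] V) : Prop where
  form : ∀ a b, B (φ a) (φ b) = S.form a b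
  endo : ∀ a, C (φ a) = φ (S.endo a)

theorem IsModel.injective {S : SkewQuadraticSpace} {φ : S.carrier →ₗ[ℂ] V}
    (hφ : IsModel S B C φ) : Function.Injective φ := by
  rw [← LinearMap.ker_eq_bot, LinearMap.ker_eq_bot']
  intro a ha
  refine S.nondeg.1 _ fun b => ?_
  rw [← hφ.form, ha, map_zero, LinearMap.zero_apply]

theorem exists_isModel_ofMatrix {ι : Type} [Fintype ι] [DecidableEq ι] {S A : Matrix ι ι ℂ}
    (hS : S.transpose = S) (hSS : S * S = 1) (hA : A.transpose * S = -(S * A)) (w : ι → V)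
    (hform : ∀ i j, B (w i) (w j) = S i j) (hendo : ∀ j, C (w j) = ∑ i, A i j • w i) :
    ∃ φ, IsModel (ofMatrix S A hS hSS hA) B C φ := by
  let φ : (ι → ℂ) →ₗ[ℂ] V := Fintype.linearCombination ℂ w
  have hφ : ∀ v, φ v = ∑ i, v i • w i := fun v => Fintype.linearCombination_apply ℂ w v
  refine ⟨φ, fun (a : ι → ℂ) (b : ι → ℂ) => ?_, fun (a : ι → ℂ) => ?_⟩
  · change B (φ a) (φ b) = Matrix.toBilin' S a b
    rw [hφ, hφ, Matrix.toBilin'_apply]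
    simp only [map_sum, map_smul, LinearMap.sum_apply, LinearMap.smul_apply, smul_eq_mul, hform]
    rw [Finset.sum_comm]
    refine Finset.sum_congr rfl fun i _ => ?_
    rw [Finset.mul_sum]
    exact Finset.sum_congr rfl fun j _ => by ring
  · change C (φ a) = φ (Matrix.toLin' A a)
    rw [hφ, hφ]
    simp only [map_sum, map_smul, hendo, Matrix.toLin'_apply, Matrix.mulVec, dotProduct,
      Finset.smul_sum, Finset.sum_smul, smul_smul]
    rw [Finset.sum_comm]
    refine Finset.sum_congr rfl fun i _ => Finset.sum_congr rfl fun j _ => by rw [mul_comm]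

/-- The constant (-1)^p is forced by G = (-1)^p C^p x: skewness gives B(G, G) = (-1)^p B(C^p x, C^p
x) = B(x, C^(2p) x) (-1)^p = 1. -/
theorem exists_isModel_jordanOdd (h : LinearMap.IsSkewFor B C) {p : ℕ} (hC : C ^ (2 * p + 1) = 0)
    {x : V} (hx : B x ((C ^ (2 * p)) x) = (-1) ^ p)
    (hx' : ∀ j, j ≠ 2 * p → B x ((C ^ j) x) = 0) : ∃ φ, IsModel (jordanOdd p) B C φ := by
  have hB : ∀ i j, B ((C ^ i) x) ((C ^ j) x) = if j + i = 2 * p then (-1) ^ i * (-1) ^ p else 0 := by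
    intro i j
    rw [h.pow_left_pow_right]
    split_ifs with hij
    · rw [hij, hx]
    · rw [hx' _ hij, mul_zero]
  have hsq : ∀ i : ℕ, ((-1 : ℂ) ^ i) * (-1) ^ i = 1 := fun i => by
    rw [← mul_pow, neg_one_mul, neg_neg, one_pow]
  have hpow : ∀ j, C ((C ^ j) x) = (C ^ (j + 1)) x := fun j => by
    rw [pow_succ', Module.End.mul_apply]
  -- The chain of x read from both ends: its bottom half gives E_1, …, E_p, G, its top half the F_j.
  -- The alternating signs produce C F_j = -F_(j+1) and C F_p = -G.
  let w : Fin (p + 1) ⊕ Fin p → V :=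
    Sum.elim (fun a => (-1 : ℂ) ^ p • (C ^ (2 * p - a)) x) (fun b => (-1 : ℂ) ^ (b : ℕ) • (C ^ (b : ℕ)) x)
  refine exists_isModel_ofMatrix _ _ _ w ?_ ?_
  · have hlr : ∀ a b, B (w (Sum.inl a)) (w (Sum.inr b)) = pairingOdd p a b := by
      intro a b
      simp only [w, Sum.elim_inl, Sum.elim_inr, map_smul, LinearMap.smul_apply, smul_eq_mul, hB,
        pairingOdd, Matrix.of_apply]
      by_cases hab : (a : ℕ) = b
      · have ha : (-1 : ℂ) ^ (2 * p - a : ℕ) = (-1) ^ (a : ℕ) := by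
          have hmul : (-1 : ℂ) ^ (2 * p - a : ℕ) * (-1) ^ (a : ℕ) = 1 := by
            rw [← pow_add, Nat.sub_add_cancel (by omega), pow_mul, neg_one_sq, one_pow]
          linear_combination (-1 : ℂ) ^ (a : ℕ) * hmul - (-1 : ℂ) ^ (2 * p - a : ℕ) * hsq a
        rw [if_pos (by omega), if_pos hab, ha, ← hab]
        linear_combination ((-1 : ℂ) ^ p * (-1) ^ p) * hsq a + hsq p
      · rw [if_neg (by omega), if_neg hab]
        ring
    rintro (a | b) (a' | b')
    · simp only [w, Sum.elim_inl, map_smul, LinearMap.smul_apply, smul_eq_mul, hB, gramOdd,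
        Matrix.fromBlocks_apply₁₁, Matrix.single_apply, Fin.ext_iff, Fin.val_last]
      by_cases haa : (a : ℕ) = p ∧ (a' : ℕ) = p
      · rw [if_pos (by omega), if_pos (by omega), show 2 * p - (a : ℕ) = p by omega]
        linear_combination ((-1 : ℂ) ^ p * (-1) ^ p) * hsq p + hsq p
      · rw [if_neg (by omega), if_neg (by omega)]
        ring
    · exact hlr a b'
    · rw [h.comm]
      exact hlr a' b
    · simp only [w, Sum.elim_inr, map_smul, LinearMap.smul_apply, smul_eq_mul, hB, gramOdd,
        Matrix.fromBlocks_apply₂₂, Matrix.zero_apply]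
      rw [if_neg (by omega)]
      ring
  · rintro (a | b)
    · simp only [Fintype.sum_sum_type, endoOdd, Matrix.fromBlocks_apply₁₁,
        Matrix.fromBlocks_apply₂₁, jordanBlock, Matrix.of_apply, Matrix.zero_apply, zero_smul,
        Finset.sum_const_zero, add_zero, ite_smul, one_smul, Fin.sum_ite_val_succ_eq]
      simp only [w, Sum.elim_inl, map_smul, hpow]
      split_ifs with ha
      · rw [show 2 * p - (a : ℕ) + 1 = 2 * p - (a - 1) by omega]
      · rw [show 2 * p - (a : ℕ) + 1 = 2 * p + 1 by omega, hC, LinearMap.zero_apply, smul_zero]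
    · simp only [Fintype.sum_sum_type, endoOdd, Matrix.fromBlocks_apply₁₂,
        Matrix.fromBlocks_apply₂₂, jordanBlock, Matrix.of_apply, Matrix.neg_apply,
        Matrix.transpose_apply, neg_smul, Finset.sum_neg_distrib, ite_and,
        ite_smul, one_smul, zero_smul, eq_comm (a := (b : ℕ) + 1), Fin.sum_ite_eq_val]
      simp only [w, Sum.elim_inl, Sum.elim_inr, map_smul, hpow]
      by_cases hb : (b : ℕ) + 1 = p
      · simp only [hb, dif_neg (lt_irrefl p), dif_pos (Nat.lt_succ_self p), if_true, neg_zero,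
          add_zero, show 2 * p - p = p by omega, ← neg_smul]
        congr 1
        have hpb : (-1 : ℂ) ^ p = (-1) ^ ((b : ℕ) + 1) := by rw [hb]
        rw [hpb, pow_succ]
        ring
      · have h1 : (b : ℕ) + 1 < p := by omega
        simp only [dif_pos h1, Ne.symm hb, if_false, ite_self, dite_eq_ite, zero_add, ← neg_smul]
        congr 1
        rw [pow_succ]
        ring

/-- The chain of y, read from its bottom, gives the E_i; that of x, with alternating signs, gives
the dual F_j. -/
theorem exists_isModel_jordanEven (h : LinearMap.IsSkewFor B C) {m : ℕ} (hC : C ^ (m + 1) = 0)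
    {x y : V} (hxy : B x ((C ^ m) y) = 1) (hxy' : ∀ j, j ≠ m → B x ((C ^ j) y) = 0)
    (hx : ∀ j, B x ((C ^ j) x) = 0) (hy : ∀ j, B y ((C ^ j) y) = 0) :
    ∃ φ, IsModel (jordanEven (m + 1)) B C φ := by
  have hsq : ∀ i : ℕ, ((-1 : ℂ) ^ i) * (-1) ^ i = 1 := fun i => by
    rw [← mul_pow, neg_one_mul, neg_neg, one_pow]
  have hpow : ∀ j z, C ((C ^ j) z) = (C ^ (j + 1)) z := fun j z => by
    rw [pow_succ', Module.End.mul_apply]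
  let w : Fin (m + 1) ⊕ Fin (m + 1) → V :=
    Sum.elim (fun a => (C ^ (m - a)) y) (fun b => (-1 : ℂ) ^ (b : ℕ) • (C ^ (b : ℕ)) x)
  refine exists_isModel_ofMatrix _ _ _ w ?_ ?_
  · have hrl : ∀ a b, B (w (Sum.inr b)) (w (Sum.inl a)) = if a = b then 1 else 0 := by
      intro a b
      simp only [w, Sum.elim_inl, Sum.elim_inr, map_smul, LinearMap.smul_apply, smul_eq_mul,
        h.pow_left_pow_right, Fin.ext_iff]
      split_ifs with hab
      · rw [show m - (a : ℕ) + b = m by omega, hxy, mul_one, hsq]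
      · rw [hxy' _ (by omega), mul_zero, mul_zero]
    rintro (a | b) (a' | b')
    · simp only [w, Sum.elim_inl, h.pow_left_pow_right, hy, mul_zero, gramEven,
        Matrix.fromBlocks_apply₁₁, Matrix.zero_apply]
    · rw [h.comm, hrl]
      simp only [gramEven, Matrix.fromBlocks_apply₁₂, Matrix.one_apply]
    · rw [hrl]
      simp only [gramEven, Matrix.fromBlocks_apply₂₁, Matrix.one_apply, eq_comm]
    · simp only [w, Sum.elim_inr, map_smul, LinearMap.smul_apply, smul_eq_mul,
        h.pow_left_pow_right, hx, mul_zero, gramEven, Matrix.fromBlocks_apply₂₂, Matrix.zero_apply]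
  · rintro (a | b)
    · simp only [Fintype.sum_sum_type, endoEven, Matrix.fromBlocks_apply₁₁,
        Matrix.fromBlocks_apply₂₁, jordanBlock, Matrix.of_apply, Matrix.zero_apply, zero_smul,
        Finset.sum_const_zero, add_zero, ite_smul, one_smul, Fin.sum_ite_val_succ_eq]
      simp only [w, Sum.elim_inl, hpow]
      split_ifs with ha
      · rw [show m - (a : ℕ) + 1 = m - (a - 1) by omega]
      · rw [show m - (a : ℕ) + 1 = m + 1 by omega, hC, LinearMap.zero_apply]
    · simp only [Fintype.sum_sum_type, endoEven, Matrix.fromBlocks_apply₁₂,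
        Matrix.fromBlocks_apply₂₂, jordanBlock, Matrix.of_apply, Matrix.neg_apply,
        Matrix.transpose_apply, Matrix.zero_apply, neg_smul, Finset.sum_neg_distrib,
        Finset.sum_const_zero, zero_add,
        ite_smul, one_smul, zero_smul, eq_comm (a := (b : ℕ) + 1), Fin.sum_ite_eq_val]
      simp only [w, Sum.elim_inr, map_smul, hpow]
      split_ifs with hb
      · rw [← neg_smul]
        congr 1
        rw [pow_succ]
        ring
      · rw [show (b : ℕ) + 1 = m + 1 by omega, hC, LinearMap.zero_apply, smul_zero, neg_zero]

/-- `S` embeds into the submodule `W` of `(V, B, C)`. -/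
def EmbedsIn (B : LinearMap.BilinForm ℂ V) (C : V →ₗ[ℂ] V) (S : SkewQuadraticSpace)
    (W : Submodule ℂ V) : Prop :=
  ∃ φ, IsModel S B C φ ∧ ∀ a, φ a ∈ W

/-- The members of `L` embed into pairwise orthogonal submodules of `(V, B, C)`. -/
def EmbedsOrthogonally (B : LinearMap.BilinForm ℂ V) (C : V →ₗ[ℂ] V)
    (L : List SkewQuadraticSpace) : Prop :=
  ∃ Ws : List (Submodule ℂ V), List.Forall₂ (EmbedsIn B C) L Ws ∧
    Ws.Pairwise fun W W' => ∀ x ∈ W, ∀ y ∈ W', B x y = 0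

/-- Needed to pass from the order in which blocks are split off to the sorted order used by a
partition. -/
theorem EmbedsOrthogonally.perm (h : LinearMap.IsSkewFor B C) {L L' : List SkewQuadraticSpace}
    (hL : EmbedsOrthogonally B C L) (hp : L'.Perm L) : EmbedsOrthogonally B C L' := by
  obtain ⟨Ws, h1, h2⟩ := hL
  obtain ⟨Ws', h3, h4⟩ := List.perm_comp_forall₂ hp h1
  refine ⟨Ws', h3, (h4.pairwise_iff ?_).mpr h2⟩
  intro W W' hW x hx y hy
  rw [h.comm]
  exact hW y hy x hx

theorem EmbedsOrthogonally.cons {S : SkewQuadraticSpace} {φ : S.carrier →ₗ[ℂ] V}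
    (hφ : IsModel S B C φ) {U : Submodule ℂ V} (hU : ∀ x ∈ U, C x ∈ U)
    (hort : ∀ a, ∀ y ∈ U, B (φ a) y = 0) {L : List SkewQuadraticSpace}
    (hL : EmbedsOrthogonally (B.restrict U) (C.restrict hU) L) :
    EmbedsOrthogonally B C (S :: L) := by
  obtain ⟨Ws, h1, h2⟩ := hL
  refine ⟨LinearMap.range φ :: Ws.map (Submodule.map U.subtype),
    List.Forall₂.cons ⟨φ, hφ, fun a => LinearMap.mem_range_self _ _⟩ ?_,
    List.Pairwise.cons ?_ ?_⟩
  · rw [List.forall₂_map_right_iff]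
    refine h1.imp ?_
    rintro T W ⟨ψ, hψ, hW⟩
    refine ⟨U.subtype ∘ₗ ψ, ⟨fun a b => hψ.form a b, fun a => ?_⟩, fun a => ⟨ψ a, hW a, rfl⟩⟩
    exact congrArg Subtype.val (hψ.endo a)
  · rintro W hW _ ⟨a, rfl⟩ y hy
    obtain ⟨W', -, rfl⟩ := List.mem_map.mp hW
    obtain ⟨z, -, rfl⟩ := hy
    exact hort a _ z.2
  · rw [List.pairwise_map]
    refine h2.imp ?_
    rintro W W' hW _ ⟨a, ha, rfl⟩ _ ⟨b, hb, rfl⟩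
    exact hW a ha b hb

/-- The image of a model is non-degenerate and C-stable, so its orthogonal is a complement, which
skewness makes C-stable. A vector of it orthogonal to it is orthogonal to everything. -/
theorem IsModel.exists_complement [FiniteDimensional ℂ V] {S : SkewQuadraticSpace}
    {φ : S.carrier →ₗ[ℂ] V} (hφ : IsModel S B C φ) (h : LinearMap.IsSkewFor B C)
    (hnd : B.Nondegenerate) :
    ∃ U : Submodule ℂ V, (∀ x ∈ U, C x ∈ U) ∧ (∀ a, ∀ y ∈ U, B (φ a) y = 0) ∧
      (B.restrict U).Nondegenerate ∧
      Module.finrank ℂ S.carrier + Module.finrank ℂ U = Module.finrank ℂ V := by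
  have hrefl : B.IsRefl := fun x y hxy => by rw [h.comm]; exact hxy
  have hmem : ∀ y, y ∈ B.orthogonal (LinearMap.range φ) ↔ ∀ a, B (φ a) y = 0 := by
    intro y
    rw [LinearMap.BilinForm.mem_orthogonal_iff]
    exact ⟨fun hy a => hy _ ⟨a, rfl⟩, fun hy => by rintro _ ⟨a, rfl⟩; exact hy a⟩
  have hr : (B.restrict (LinearMap.range φ)).Nondegenerate := by
    refine LinearMap.BilinForm.nondegenerate_of_symm (fun x y => h.comm _ _) ?_
    rintro ⟨_, a, rfl⟩ ha
    have : a = 0 := S.nondeg.1 _ fun b => by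
      rw [← hφ.form]
      exact ha ⟨φ b, b, rfl⟩
    subst this
    exact Subtype.ext (map_zero φ)
  have hcompl := LinearMap.BilinForm.isCompl_orthogonal_of_restrict_nondegenerate hrefl hr
  refine ⟨B.orthogonal (LinearMap.range φ), fun x hx => ?_, fun a y hy => (hmem y).mp hy a, ?_, ?_⟩
  · rw [hmem] at hx ⊢
    intro a
    have := h.skew (φ a) x
    rw [hφ.endo, hx] at this
    simpa using this.symm
  · refine LinearMap.BilinForm.nondegenerate_of_symm (fun x y => h.comm _ _) ?_
    rintro ⟨x, hx⟩ hx'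
    refine Subtype.ext (hnd.1 x fun v => ?_)
    obtain ⟨y, ⟨a, rfl⟩, z, hz, rfl⟩ := Submodule.mem_sup.mp
      (hcompl.sup_eq_top.symm ▸ Submodule.mem_top (x := v))
    rw [map_add, h.comm x, (hmem x).mp hx, zero_add]
    exact hx' ⟨z, hz⟩
  · rw [← Submodule.finrank_add_eq_of_isCompl hcompl, LinearMap.finrank_range_of_inj hφ.injective]

theorem exists_embedsOrthogonally (N : ℕ) : ∀ (V : Type u) [AddCommGroup V] [Module ℂ V]
    [FiniteDimensional ℂ V] (B : LinearMap.BilinForm ℂ V) (C : V →ₗ[ℂ] V),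
    LinearMap.IsSkewFor B C → B.Nondegenerate → IsNilpotent C → Module.finrank ℂ V = N →
    ∃ evens odds : List ℕ, (∀ p ∈ evens, Even p ∧ 0 < p) ∧
      2 * evens.sum + (odds.map fun q => 2 * q + 1).sum = N ∧
      EmbedsOrthogonally B C (evens.map jordanEven ++ odds.map jordanOdd) := by
  induction N using Nat.strong_induction_on with
  | _ N ih =>
  intro V _ _ _ B C h hnd hnil hN
  rcases Nat.eq_zero_or_pos N with rfl | hpos
  · exact ⟨[], [], by simp, rfl, [], List.Forall₂.nil, List.Pairwise.nil⟩
  have : Nontrivial V := Module.nontrivial_of_finrank_pos (R := ℂ) (hN ▸ hpos)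
  have hrec : ∀ (S : SkewQuadraticSpace) (φ : S.carrier →ₗ[ℂ] V), IsModel S B C φ →
      0 < Module.finrank ℂ S.carrier →
      ∃ evens odds : List ℕ, (∀ p ∈ evens, Even p ∧ 0 < p) ∧
        Module.finrank ℂ S.carrier + (2 * evens.sum + (odds.map fun q => 2 * q + 1).sum) = N ∧
        EmbedsOrthogonally B C (S :: (evens.map jordanEven ++ odds.map jordanOdd)) := by
    intro S φ hφ hS
    obtain ⟨U, hU, hort, hUnd, hdim⟩ := hφ.exists_complement h hnd
    obtain ⟨k, hk⟩ := hnil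
    obtain ⟨evens, odds, he, hsum, hemb⟩ := ih (Module.finrank ℂ U) (by omega) U (B.restrict U)
      (C.restrict hU) ⟨fun x y => h.comm _ _, fun x y => h.skew _ _⟩ hUnd
      ⟨k, by
        rw [Module.End.pow_restrict k]
        ext x
        simp [hk]⟩ rfl
    exact ⟨evens, odds, he, by omega, hemb.cons hφ hU hort⟩
  obtain ⟨m, hm, hm'⟩ : ∃ m, C ^ (m + 1) = 0 ∧ C ^ m ≠ 0 := by
    have hc : nilpotencyClass C ≠ 0 := fun h0 => by
      have := pow_nilpotencyClass hnil
      rw [h0, pow_zero] at this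
      exact one_ne_zero this
    refine ⟨nilpotencyClass C - 1, ?_, pow_pred_nilpotencyClass hnil⟩
    rw [Nat.sub_add_cancel (Nat.one_le_iff_ne_zero.mpr hc)]
    exact pow_nilpotencyClass hnil
  obtain ⟨x₀, y₀, hxy⟩ : ∃ x y, B x ((C ^ m) y) ≠ 0 := by
    by_contra! h'
    exact hm' (LinearMap.ext fun y => hnd.2 _ fun x => h' x y)
  rcases Nat.even_or_odd m with he | ho
  -- For even m the form B(x, C^m y) is symmetric, so by polarization it is nonzero on some diagonal
  -- pair.
  · obtain ⟨z, hz⟩ : ∃ z, B z ((C ^ m) z) ≠ 0 := by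
      by_contra! h'
      have h1 := h' (x₀ + y₀)
      have h2 := h.pow_comm m y₀ x₀
      rw [he.neg_one_pow, one_mul] at h2
      simp only [map_add, LinearMap.add_apply, h', h2, zero_add, add_zero] at h1
      exact hxy (self_eq_neg.mp (eq_neg_of_add_eq_zero_left h1))
    obtain ⟨p, hp⟩ := he
    obtain rfl : m = 2 * p := by omega
    obtain ⟨x, hx, hx'⟩ := h.exists_normalized hm (even_two_mul p) hz
      (pow_ne_zero p (neg_ne_zero.mpr one_ne_zero) : ((-1 : ℂ) ^ p) ≠ 0)
    obtain ⟨φ, hφ⟩ := exists_isModel_jordanOdd h hm hx hx'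
    obtain ⟨evens, odds, hev, hsum, hemb⟩ := hrec _ φ hφ (by rw [finrank_jordanOdd]; omega)
    rw [finrank_jordanOdd] at hsum
    refine ⟨evens, p :: odds, hev, ?_, hemb.perm h ?_⟩
    · rw [List.map_cons, List.sum_cons]
      omega
    · rw [List.map_cons]
      exact List.perm_middle
  · obtain ⟨x, y, h1, h2, h3, h4⟩ := h.exists_normalized_pair hm ho hxy
    obtain ⟨φ, hφ⟩ := exists_isModel_jordanEven h hm h1 h2 h3 h4
    obtain ⟨evens, odds, hev, hsum, hemb⟩ := hrec _ φ hφ (by rw [finrank_jordanEven]; omega)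
    rw [finrank_jordanEven] at hsum
    refine ⟨(m + 1) :: evens, odds, ?_, ?_, hemb⟩
    · rintro p (_ | ⟨_, hp⟩)
      · exact ⟨ho.add_one, by omega⟩
      · exact hev p hp
    · rw [List.sum_cons]
      omega

theorem directSum_form_apply {ι : Type} [Fintype ι] (D : ι → SkewQuadraticSpace)
    (a b : ∀ i, (D i).carrier) : (directSum D).form a b = ∑ i, (D i).form (a i) (b i) := by
  change (∑ i, (D i).form.compl₁₂ (LinearMap.proj i) (LinearMap.proj i) :
    LinearMap.BilinForm ℂ (∀ i, (D i).carrier)) a b = _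
  simp only [LinearMap.coe_sum, Finset.sum_apply, LinearMap.compl₁₂_apply, LinearMap.proj_apply]

theorem exists_isModel_directSum {ι : Type} [Fintype ι] {D : ι → SkewQuadraticSpace}
    {ψ : ∀ i, (D i).carrier →ₗ[ℂ] V} (hψ : ∀ i, IsModel (D i) B C (ψ i))
    (hort : ∀ i j, i ≠ j → ∀ a b, B (ψ i a) (ψ j b) = 0) :
    ∃ φ, IsModel (directSum D) B C φ := by
  let φ : (∀ i, (D i).carrier) →ₗ[ℂ] V := ∑ i, ψ i ∘ₗ LinearMap.proj i
  have hφ : ∀ a : ∀ i, (D i).carrier, φ a = ∑ i, ψ i (a i) := fun a => by simp [φ]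
  refine ⟨φ, fun (a b : ∀ i, (D i).carrier) => ?_, fun (a : ∀ i, (D i).carrier) => ?_⟩
  · refine Eq.trans ?_ (directSum_form_apply D a b).symm
    refine (congrArg₂ (fun x y => B x y) (hφ a) (hφ b)).trans ?_
    simp only [map_sum, LinearMap.sum_apply]
    refine Finset.sum_congr rfl fun i _ => ?_
    rw [Finset.sum_eq_single i (fun j _ hj => hort j i hj _ _) (by simp)]
    exact (hψ i).form _ _
  · refine (congrArg C (hφ a)).trans (Eq.trans ?_ (hφ _).symm)
    rw [map_sum]
    exact Finset.sum_congr rfl fun i _ => (hψ i).endo _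

theorem EmbedsOrthogonally.exists_isModel_directSum (h : LinearMap.IsSkewFor B C)
    {L : List SkewQuadraticSpace} (hL : EmbedsOrthogonally B C L) :
    ∃ φ, IsModel (directSum L.get) B C φ := by
  obtain ⟨Ws, h1, h2⟩ := hL
  rw [List.forall₂_iff_get] at h1
  obtain ⟨hlen, h1⟩ := h1
  choose ψ hψ hmem using fun i : Fin L.length => h1 i i.2 (hlen ▸ i.2)
  rw [List.pairwise_iff_get] at h2
  refine SkewQuadraticSpace.exists_isModel_directSum hψ fun i j hij a b => ?_
  rcases lt_or_gt_of_ne hij with hij | hij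
  · exact h2 ⟨i, hlen ▸ i.2⟩ ⟨j, hlen ▸ j.2⟩ hij _ (hmem i a) _ (hmem j b)
  · rw [h.comm]
    exact h2 ⟨j, hlen ▸ j.2⟩ ⟨i, hlen ▸ i.2⟩ hij _ (hmem j b) _ (hmem i a)

end SkewQuadraticSpace

/-! ### Singular nilpotent quadratic Lie algebras are double extensions -/

namespace QuadraticLieAlgebra

variable (g : QuadraticLieAlgebra.{u})

theorem form_comm (x y : g.carrier) : g.form x y = g.form y x := g.symm.eq x y

theorem form_lie_left (x y z : g.carrier) : g.form ⁅x, y⁆ z = -g.form y ⁅x, z⁆ := by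
  rw [← lie_skew, map_neg, LinearMap.neg_apply, g.invariant]

theorem wedge_apply (α : Module.Dual ℂ g.carrier) (a b c d : g.carrier) :
    wedgeThreeForm g.threeForm α ![a, b, c, d] =
      α a * g.form ⁅b, c⁆ d - α b * g.form ⁅a, c⁆ d + α c * g.form ⁅a, b⁆ d -
        α d * g.form ⁅a, b⁆ c := by
  exact wedgeThreeForm_apply _ _ _

theorem threeForm_invariant (y b c d : g.carrier) :
    g.form ⁅⁅y, b⁆, c⁆ d + g.form ⁅b, ⁅y, c⁆⁆ d + g.form ⁅b, c⁆ ⁅y, d⁆ = 0 := by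
  have h := g.form_lie_left y ⁅b, c⁆ d
  rw [leibniz_lie, map_add, LinearMap.add_apply] at h
  rw [h, neg_add_cancel]

/-- The ideal of all `X` with `B(X, ·) ∧ I = 0`. -/
def wedgeIdeal : LieIdeal ℂ g.carrier where
  toSubmodule := (LinearMap.ker (wedgeThreeForm g.threeForm)).comap g.form
  lie_mem {y x} hx := by
    have hx' : ∀ a b c d, g.form x a * g.form ⁅b, c⁆ d - g.form x b * g.form ⁅a, c⁆ d +
        g.form x c * g.form ⁅a, b⁆ d - g.form x d * g.form ⁅a, b⁆ c = 0 := by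
      intro a b c d
      rw [← wedge_apply]
      exact congrArg (fun f => f ![a, b, c, d]) (LinearMap.mem_ker.mp (Submodule.mem_comap.mp hx))
    refine Submodule.mem_comap.mpr (LinearMap.mem_ker.mpr (AlternatingMap.ext fun v => ?_))
    have hv : v = ![v 0, v 1, v 2, v 3] := by
      ext i
      fin_cases i <;> rfl
    rw [hv, wedge_apply]
    generalize v 0 = a
    generalize v 1 = b
    generalize v 2 = c
    generalize v 3 = d
    simp only [form_lie_left g y x, AlternatingMap.zero_apply]
    -- Leibniz rule: let ad y act on each argument of B(x, ·) ∧ I in turn. The terms acting on I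
    -- cancel by invariance, and the others give -B([y, x], ·) ∧ I.
    linear_combination g.form x a * g.threeForm_invariant y b c d -
      g.form x b * g.threeForm_invariant y a c d + g.form x c * g.threeForm_invariant y a b d -
      g.form x d * g.threeForm_invariant y a b c - hx' ⁅y, a⁆ b c d - hx' a ⁅y, b⁆ c d -
      hx' a b ⁅y, c⁆ d - hx' a b c ⁅y, d⁆

theorem wedge_of_mem_wedgeIdeal {x : g.carrier} (hx : x ∈ g.wedgeIdeal) (a b c d : g.carrier) :
    g.form x a * g.form ⁅b, c⁆ d - g.form x b * g.form ⁅a, c⁆ d +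
      g.form x c * g.form ⁅a, b⁆ d - g.form x d * g.form ⁅a, b⁆ c = 0 := by
  rw [← wedge_apply]
  exact congrArg (fun f => f ![a, b, c, d]) (LinearMap.mem_ker.mp (Submodule.mem_comap.mp hx))

/-- A nonzero ideal of a nilpotent Lie algebra contains a nonzero central element. -/
theorem exists_central (hnil : LieRing.IsNilpotent g.carrier) (hdup : 1 ≤ g.dup) :
    ∃ x ≠ 0, x ∈ g.wedgeIdeal ∧ ∀ y : g.carrier, ⁅y, x⁆ = 0 := by
  have : Nontrivial (LinearMap.ker (wedgeThreeForm g.threeForm)) :=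
    Module.nontrivial_of_finrank_pos (R := ℂ) hdup
  obtain ⟨⟨α, hα⟩, hne⟩ := exists_ne (0 : LinearMap.ker (wedgeThreeForm g.threeForm))
  obtain ⟨x, rfl⟩ : ∃ x, g.form x = α := by
    refine ⟨(LinearMap.BilinForm.toDual g.form g.nondeg).symm α, ?_⟩
    ext v
    exact LinearMap.BilinForm.apply_toDual_symm_apply (hB := g.nondeg) α v
  have hx0 : x ≠ 0 := by
    rintro rfl
    exact hne (Subtype.ext (map_zero g.form))
  have : Nontrivial g.wedgeIdeal :=
    ⟨⟨⟨x, hα⟩, 0, fun h => hx0 (congrArg Subtype.val h)⟩⟩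
  have hn : LieModule.IsNilpotent g.carrier g.wedgeIdeal :=
    Function.Injective.lieModuleIsNilpotent (R := ℂ) (f := LieHom.id)
      (g := g.wedgeIdeal.toSubmodule.subtype) (fun _ _ => rfl) Subtype.val_injective
  have := LieModule.nontrivial_max_triv_of_isNilpotent ℂ g.carrier g.wedgeIdeal
  obtain ⟨⟨z, hz⟩, hz0⟩ := exists_ne (0 : LieModule.maxTrivSubmodule ℂ g.carrier g.wedgeIdeal)
  exact ⟨z, fun h => hz0 (Subtype.ext (Subtype.ext h)), z.2, fun y => congrArg Subtype.val (hz y)⟩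

/-- The evident map from the double extension is isometric, hence injective, and bijective by
dimension. -/
theorem iIsom_doubleExtension (D : SkewQuadraticSpace) (φ : D.carrier →ₗ[ℂ] g.carrier)
    (X Y : g.carrier) (hform : ∀ a b, g.form (φ a) (φ b) = D.form a b)
    (hXX : g.form X X = 0) (hYY : g.form Y Y = 0) (hXY : g.form X Y = 1)
    (hX : ∀ a, g.form X (φ a) = 0) (hY : ∀ a, g.form Y (φ a) = 0)
    (hcentral : ∀ v : g.carrier, ⁅v, X⁆ = 0) (hlieY : ∀ a, ⁅Y, φ a⁆ = φ (D.endo a))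
    (hlie : ∀ a b, ⁅φ a, φ b⁆ = D.form (D.endo a) b • X)
    (hdim : Module.finrank ℂ g.carrier = Module.finrank ℂ D.carrier + 2) :
    g.IIsom D.doubleExtension := by
  have hX' : ∀ a, g.form (φ a) X = 0 := fun a => by rw [g.form_comm, hX]
  have hY' : ∀ a, g.form (φ a) Y = 0 := fun a => by rw [g.form_comm, hY]
  have hYX : g.form Y X = 1 := by rw [g.form_comm, hXY]
  have hcentral' : ∀ v : g.carrier, ⁅X, v⁆ = 0 := fun v => by rw [← lie_skew, hcentral, neg_zero]
  have hlieY' : ∀ a, ⁅φ a, Y⁆ = -φ (D.endo a) := fun a => by rw [← lie_skew, hlieY]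
  let ψ : D.Ext →ₗ⁅ℂ⁆ g.carrier :=
    { toFun := fun u => φ u.q + u.x • X + u.y • Y
      map_add' := fun u v => by
        simp only [SkewQuadraticSpace.Ext.add_q, SkewQuadraticSpace.Ext.add_x,
          SkewQuadraticSpace.Ext.add_y, map_add]
        module
      map_smul' := fun c u => by
        simp only [SkewQuadraticSpace.Ext.smul_q, SkewQuadraticSpace.Ext.smul_x,
          SkewQuadraticSpace.Ext.smul_y, map_smul, RingHom.id_apply]
        module
      map_lie' := fun {u v} => by
        simp only [SkewQuadraticSpace.Ext.lie_q, SkewQuadraticSpace.Ext.lie_x,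
          SkewQuadraticSpace.Ext.lie_y, add_lie, lie_add, smul_lie, lie_smul, hcentral, hcentral',
          hlieY, hlieY', hlie, lie_self, map_sub, map_smul]
        module }
  have hψ : ∀ u, ψ u = φ u.q + u.x • X + u.y • Y := fun _ => rfl
  have hiso : ∀ u v, g.form (ψ u) (ψ v) = D.extForm u v := by
    intro u v
    rw [hψ, hψ, SkewQuadraticSpace.extForm_apply]
    simp only [map_add, map_smul, LinearMap.add_apply, LinearMap.smul_apply, smul_eq_mul, hform,
      hXX, hYY, hXY, hYX, hX, hX', hY, hY']
    ring
  have hinj : Function.Injective (ψ : D.Ext →ₗ[ℂ] g.carrier) := by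
    rw [← LinearMap.ker_eq_bot, LinearMap.ker_eq_bot']
    intro u hu
    refine D.extForm_nondeg.1 u fun v => ?_
    rw [← hiso]
    have hu' : ψ u = 0 := hu
    rw [hu', map_zero, LinearMap.zero_apply]
  have hbij : Function.Bijective ψ :=
    ⟨hinj, (LinearMap.injective_iff_surjective_of_finrank_eq_finrank
      (D.finrank_ext.trans hdim.symm)).mp hinj⟩
  let e := LieEquiv.ofBijective ψ hbij
  refine ⟨e.symm, fun x y => ?_⟩
  have h1 : ∀ z, ψ (e.symm z) = z := fun z => e.apply_symm_apply z
  change D.extForm (e.symm x) (e.symm y) = _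
  rw [← hiso, h1, h1]

/-- A nilpotent non-Abelian quadratic Lie algebra with `dup ≥ 1` splits as
`𝔮 ⊕ ℂ X ⊕ ℂ Y`. -/
theorem exists_splitting (hnil : LieRing.IsNilpotent g.carrier) (hs : g.IsSingular) :
    ∃ X Y : g.carrier, g.form X X = 0 ∧ g.form Y Y = 0 ∧ g.form X Y = 1 ∧
      (∀ v : g.carrier, ⁅v, X⁆ = 0) ∧ ∀ b c : g.carrier, g.form X b = 0 → g.form X c = 0 →
        ⁅b, c⁆ = g.form ⁅Y, b⁆ c • X := by
  obtain ⟨X, hX0, hmem, hcentral⟩ := g.exists_central hnil hs.2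
  have hw := g.wedge_of_mem_wedgeIdeal hmem
  have hcentral' : ∀ v : g.carrier, ⁅X, v⁆ = 0 := fun v => by rw [← lie_skew, hcentral, neg_zero]
  -- Inserting the central X as first argument leaves B(X, X) I(b, c, d) = 0; were B(X, X) nonzero,
  -- I and the bracket would vanish.
  have hXX : g.form X X = 0 := by
    by_contra hne
    refine hs.1 ⟨fun b c => g.nondeg.1 _ fun d => ?_⟩
    have := hw X b c d
    simp only [hcentral', map_zero, LinearMap.zero_apply, mul_zero, sub_zero, add_zero,
      mul_eq_zero] at this
    exact this.resolve_left hne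
  obtain ⟨Y₀, hY₀⟩ : ∃ y, g.form X y ≠ 0 := by
    by_contra! h
    exact hX0 (g.nondeg.1 X h)
  obtain ⟨Y₁, hY₁⟩ : ∃ y, g.form X y = 1 :=
    ⟨(g.form X Y₀)⁻¹ • Y₀, by rw [map_smul, smul_eq_mul, inv_mul_cancel₀ hY₀]⟩
  have hY₁' : g.form Y₁ X = 1 := by rw [g.form_comm, hY₁]
  refine ⟨X, Y₁ - (g.form Y₁ Y₁ / 2) • X, hXX, ?_, ?_, hcentral, fun b c hb hc => ?_⟩
  · simp only [map_sub, map_smul, LinearMap.sub_apply, LinearMap.smul_apply, smul_eq_mul, hXX,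
      hY₁, hY₁']
    ring
  · simp only [map_sub, map_smul, smul_eq_mul, hXX, hY₁]
    ring
  · rw [sub_lie, smul_lie, hcentral', smul_zero, sub_zero, ← sub_eq_zero]
    refine g.nondeg.1 _ fun d => ?_
    -- Since B(X, Y₁) = 1 and b, c ∈ X^⊥, the wedge identity reads I(b, c, d) = -B(X, c) I(Y₁, b, d)
    -- + B(X, b) I(Y₁, c, d) + B(X, d) I(Y₁, b, c), in which only the last term survives.
    have := hw Y₁ b c d
    rw [hY₁, hb, hc] at this
    simp only [map_sub, map_smul, LinearMap.sub_apply, LinearMap.smul_apply, smul_eq_mul]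
    linear_combination this

end QuadraticLieAlgebra

namespace SkewQuadraticSpace

theorem sum_get_eq (L : List SkewQuadraticSpace) (f : SkewQuadraticSpace → ℕ) :
    ∑ i, f (L.get i) = (L.map f).sum := by
  rw [← List.sum_ofFn]
  exact congrArg List.sum (List.ofFn_getElem_eq_map L f)

theorem finrank_directSum_lists (evens odds : List ℕ) :
    Module.finrank ℂ (directSum (evens.map jordanEven ++ odds.map jordanOdd).get).carrier =
      2 * evens.sum + (odds.map fun q => 2 * q + 1).sum := by
  rw [finrank_directSum, sum_get_eq _ fun D => Module.finrank ℂ D.carrier]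
  simp only [List.map_append, List.map_map, List.sum_append, Function.comp_def,
    finrank_jordanEven, finrank_jordanOdd]
  rw [List.sum_map_mul_left, List.map_id']

theorem jordanOdd_zero_endo : (jordanOdd 0).endo = 0 := by
  have : endoOdd 0 = 0 := by
    ext (i | i) (j | j)
    · simp [endoOdd, jordanBlock]
    · exact j.elim0
    · exact i.elim0
    · exact i.elim0
  change Matrix.toLin' (endoOdd 0) = 0
  rw [this, map_zero]

theorem directSum_endo_eq_zero {ι : Type} [Fintype ι] {D : ι → SkewQuadraticSpace}
    (h : ∀ i, (D i).endo = 0) : (directSum D).endo = 0 := by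
  refine LinearMap.ext fun (a : ∀ i, (D i).carrier) => funext fun i => ?_
  change (D i).endo (a i) = 0
  rw [h, LinearMap.zero_apply]

end SkewQuadraticSpace

/-! ### Every nilpotent singular algebra is some 𝔤_[d] -/

namespace QuadraticLieAlgebra

open SkewQuadraticSpace

theorem exists_iIsom_lieAlgebra {n : ℕ} (g : QuadraticLieAlgebra.{u})
    (hg : g.IsNilpotentSingular (n + 2)) : ∃ d : SpecialPartition n, g.IIsom d.lieAlgebra := by
  obtain ⟨hdim, hnil, hs⟩ := hg
  obtain ⟨X, Y, hXX, hYY, hXY, hcentral, hlie⟩ := g.exists_splitting hnil hs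
  have hYX : g.form Y X = 1 := by rw [g.form_comm, hXY]
  have hcentral' : ∀ v : g.carrier, ⁅X, v⁆ = 0 := fun v => by rw [← lie_skew, hcentral, neg_zero]
  let π : g.carrier →ₗ[ℂ] ℂ × ℂ := (g.form X).prod (g.form Y)
  let W : Submodule ℂ g.carrier := LinearMap.ker π
  have hW : ∀ v, v ∈ W ↔ g.form X v = 0 ∧ g.form Y v = 0 := fun v => by
    simp [W, π, LinearMap.mem_ker]
  have hWdim : Module.finrank ℂ W = n := by
    have hsurj : LinearMap.range π = ⊤ := by
      rw [LinearMap.range_eq_top]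
      rintro ⟨s, t⟩
      exact ⟨s • Y + t • X, by simp [π, hXX, hYY, hXY, hYX]⟩
    have h1 := π.finrank_range_add_finrank_ker
    rw [hsurj, finrank_top, Module.finrank_prod, Module.finrank_self, hdim] at h1
    change Module.finrank ℂ (LinearMap.ker π) = n
    omega
  let C₀ : g.carrier →ₗ[ℂ] g.carrier := LieAlgebra.ad ℂ g.carrier Y
  have hC₀ : ∀ v, C₀ v = ⁅Y, v⁆ := fun _ => rfl
  have hC₀W : ∀ v ∈ W, C₀ v ∈ W := fun v _ => by
    rw [hW, hC₀]
    constructor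
    · rw [← g.invariant, hcentral', map_zero, LinearMap.zero_apply]
    · rw [← g.invariant, lie_self, map_zero, LinearMap.zero_apply]
  have hskew : LinearMap.IsSkewFor (g.form.restrict W) (C₀.restrict hC₀W) :=
    ⟨fun x y => g.form_comm _ _, fun x y => g.form_lie_left _ _ _⟩
  have hnd : (g.form.restrict W).Nondegenerate := by
    refine LinearMap.BilinForm.nondegenerate_of_symm hskew.comm ?_
    rintro ⟨x, hx⟩ h
    refine Subtype.ext (g.nondeg.1 x fun v => ?_)
    have hx' := (hW x).mp hx
    have hv : v - g.form Y v • X - g.form X v • Y ∈ W := by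
      rw [hW]
      constructor <;> simp [hXX, hYY, hXY, hYX]
    have := h ⟨_, hv⟩
    change g.form x (v - g.form Y v • X - g.form X v • Y) = 0 at this
    rw [map_sub, map_sub, map_smul, map_smul, g.form_comm x X, g.form_comm x Y, hx'.1, hx'.2] at this
    simpa using this
  have hCnil : IsNilpotent (C₀.restrict hC₀W) := by
    obtain ⟨k, hk⟩ : IsNilpotent C₀ :=
      LieModule.isNilpotent_toEnd_of_isNilpotent ℂ g.carrier g.carrier Y
    refine ⟨k, ?_⟩
    rw [Module.End.pow_restrict k]
    ext x
    simp [hk]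
  obtain ⟨evens, odds, hev, hsum, hemb⟩ := exists_embedsOrthogonally n W _ _ hskew hnd hCnil hWdim
  -- If all blocks had size 1, ad Y would vanish on W, so Y would be central and [b, c] = B([Y, b],
  -- c) X would make the algebra Abelian.
  have hne : evens ≠ [] ∨ ∃ q ∈ odds, q ≠ 0 := by
    by_contra! hall
    obtain ⟨rfl, hodds⟩ := hall
    obtain ⟨φ, hφ⟩ := hemb.exists_isModel_directSum hskew
    have hsurj : Function.Surjective φ :=
      (LinearMap.injective_iff_surjective_of_finrank_eq_finrank
        ((finrank_directSum_lists _ _).trans (hsum.trans hWdim.symm))).mp hφ.injective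
    have hzero : (directSum (List.map jordanEven [] ++ odds.map jordanOdd).get).endo = 0 := by
      have hmem : ∀ D ∈ List.map jordanEven [] ++ odds.map jordanOdd, D.endo = 0 := by
        intro D hD
        rw [List.map_nil, List.nil_append, List.mem_map] at hD
        obtain ⟨q, hq, rfl⟩ := hD
        rw [hodds q hq, jordanOdd_zero_endo]
      exact directSum_endo_eq_zero fun i => hmem _ (List.get_mem _ i)
    have hYW : ∀ w ∈ W, ⁅Y, w⁆ = 0 := by
      intro w hw
      obtain ⟨a, ha⟩ := hsurj ⟨w, hw⟩
      have := hφ.endo a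
      rw [hzero, LinearMap.zero_apply, map_zero, ha] at this
      exact congrArg Subtype.val this
    have hY : ∀ v : g.carrier, ⁅Y, v⁆ = 0 := by
      intro v
      have hv : v - g.form Y v • X - g.form X v • Y ∈ W := by
        rw [hW]
        constructor <;> simp [hXX, hYY, hXY, hYX]
      have := hYW _ hv
      simpa [hcentral] using this
    have hY' : ∀ v : g.carrier, ⁅v, Y⁆ = 0 := fun v => by rw [← lie_skew, hY, neg_zero]
    refine hs.1 ⟨fun b c => ?_⟩
    -- Subtracting a multiple of the central Y moves b into X^⊥ without changing its brackets.
    have hb : g.form X (b - g.form X b • Y) = 0 := by simp [hXY]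
    have hc : g.form X (c - g.form X c • Y) = 0 := by simp [hXY]
    have := hlie _ _ hb hc
    simpa [hY, hY'] using this
  obtain ⟨d, hde, hdo⟩ := SpecialPartition.exists_of_lists evens odds hev hsum hne
  refine ⟨d, ?_⟩
  obtain ⟨φ, hφ⟩ := (hemb.perm hskew ((hde.map jordanEven).append
    (hdo.map jordanOdd))).exists_isModel_directSum hskew
  have hφX : ∀ a, g.form X (φ a) = 0 := fun a => ((hW _).mp (φ a).2).1
  have hφY : ∀ a, g.form Y (φ a) = 0 := fun a => ((hW _).mp (φ a).2).2
  refine g.iIsom_doubleExtension d.skewSpace (W.subtype ∘ₗ φ) X Y hφ.form hXX hYY hXY hφX hφY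
    hcentral (fun a => congrArg Subtype.val (hφ.endo a)) (fun a b => ?_) ?_
  · have hform := hφ.form (d.skewSpace.endo a) b
    refine (hlie _ _ (hφX a) (hφX b)).trans (congrArg (· • X) ?_)
    refine Eq.trans ?_ hform
    exact congrArg (fun z : W => g.form z (φ b)) (hφ.endo a)
  · rw [hdim, d.finrank_skewSpace]

end QuadraticLieAlgebra

theorem proposition5p4 (n : ℕ) (hn : 1 ≤ n) :
    (∃ h : ∀ d : SpecialPartition n, d.lieAlgebra.IsNilpotentSingular (n + 2),
      Function.Bijective (fun d : SpecialPartition n =>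
        (Quotient.mk _ ⟨d.lieAlgebra, h d⟩ :
          QuadraticLieAlgebra.NilpotentSingularClasses.{0} (n + 2)))) ∧
    (∀ g : QuadraticLieAlgebra.{u}, g.IsNilpotentSingular (n + 2) →
      ∃! d : SpecialPartition n, g.IIsom d.lieAlgebra) := by
  refine ⟨⟨fun d => d.lieAlgebra_isNilpotentSingular, fun d d' h => ?_, fun c => ?_⟩,
    fun g hg => ?_⟩
  · exact SpecialPartition.eq_of_isom (Quotient.exact h)
  · obtain ⟨⟨g, hg⟩, rfl⟩ := Quotient.exists_rep c
    obtain ⟨d, e, -⟩ := g.exists_iIsom_lieAlgebra hg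
    exact ⟨d, Quotient.sound ⟨e.symm⟩⟩
  · obtain ⟨d, hd⟩ := g.exists_iIsom_lieAlgebra hg
    refine ⟨d, hd, fun d' hd' => ?_⟩
    obtain ⟨e, -⟩ := hd
    obtain ⟨e', -⟩ := hd'
    -- Uniqueness uses only the underlying Lie algebra isomorphisms.
    exact SpecialPartition.eq_of_isom ⟨e'.symm.trans e⟩
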